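/- Let $S$ be a commutative $\omega$-continuous semiring: it is partially ordered by its natural order $a\le b\Leftrightarrow\exists d\; a+d=b$, suprema of $\omega$-chains exist, and $+$ and $\cdot$ preserve them in each argument. Countable sums in $S$ are the suprema of their finite partial sums. Let $k\ge 1$ be an integer such that $k=k+1$ holds in $S$ ($k$ denoting $1+\dots+1$, $k$ times). Let $G$ be a context-free grammar with finite alphabet $A$, a finite set $\mathcal X$ of $n$ variables and finitely many rules, and let $h\colon A\to S$ be a valuation. Consider the algebraic system $X=f_X$ $(X\in\mathcal X)$ associated with $G$, where $f_X=\sum_{X\to\gamma}\gamma$ is read over $S$ with each letter $a$ interpreted as $h(a)$. For a variable $X$ of a grammar, let $\mathrm{camb}_X\colon\mathbb N^A\to\mathbb N\cup\{\infty\}$ map a vector $v$ to the number of derivation trees with root variable $X$ whose yield has Parikh vector $v$. For $s\colon\mathbb N^A\to\mathbb N\cup\{\infty\}$ put $h(s)=\sum_{v\in\mathbb N^A}s(v)\prod_{a\in A}h(a)^{v(a)}$, where $\infty$ is read as $\sum_{i\in\mathbb N}1$ in $S$. For $d\in\mathbb N$ let $G^{\le d}$ be the grammar over $A$ with variables $X^{\le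 e},X^{=e}$ ($X\in\mathcal X$, $0\le e\le d$) and exactly the following rules: - $X^{\le e}\to X^{=e'}$ for all $X\in\mathcal X$ and $0\le e'\le e\le d$; - $X^{=0}\to u_0$ for each rule $X\to u_0$ of $G$ without variables on the right-hand side; - $X^{=e}\to u_0X_1^{=e}u_1$ for each rule $X\to u_0X_1u_1$ of $G$ with exactly one variable occurrence and all $0\le e\le d$; - for each rule $X\to u_0X_1u_1\cdots X_ru_r$ of $G$ with $r\ge2$ variable occurrences and all $1\le e\le d$, the rules $X^{=e}\to u_0Z_1u_1\cdots Z_ru_r$ where either, for some $j$, $Z_j=X_j^{=e}$ and $Z_i=X_i^{\le e-1}$ for all $i\ne j$; or, for some $J\subseteq\{1,\dots,r\}$ with $|J|\ge 2$, $Z_i=X_i^{=e-1}$ for $i\in J$ and $Z_i=X_i^{\le e-2}$ for $i\notin J$ (the latter only if $e\ge2$ or $J=\{1,\dots,r\}$, so that all $Z_i$ are defined). Put $d=n+\lceil\log_2\log_2 k\rceil$ if $k\ge 2$, and $d=n$ if $k=1$. Then: 1. The least solution of the system over $S$ is $\bigl(h(\mathrm{camb}_{X^{\le d}})\bigr)_{X\in\mathcal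 X}$, where $\mathrm{camb}_{X^{\le d}}$ is taken in $G^{\le d}$. 2. Newton's method reaches the least solution after at most $d$ steps. That is, call $(\nu^{(i)})_{i\in\mathbb N}$ a Newton sequence if $\nu^{(0)}=f(0)$ and, for every $i$, $\nu^{(i+1)}=\nu^{(i)}+\Delta$, where $\Delta$ is the least solution of $y=Df|_{\nu^{(i)}}(y)+\delta$ for some $\delta$ with $f(\nu^{(i)})=\nu^{(i)}+\delta$ (here $Df|_u$ is the formal differential of the polynomial map $f$ at $u$). Then Newton sequences exist, and every Newton sequence satisfies that $\nu^{(i)}$ is the least solution for all $i\ge d$. -/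

import Mathlib

namespace CamNewton

/-! ### Commutative ω-continuous semirings -/

/-- An ω-continuous semiring. `CanonicallyOrderedAdd` says that `≤` is the natural order
`a ≤ b ↔ ∃ d, b = a + d`. Suprema of ω-chains exist, and addition and multiplication preserve
them in each argument. -/
class OmegaContinuous (S : Type*) [Semiring S] [PartialOrder S] [CanonicallyOrderedAdd S] :
    Prop where
  exists_isLUB : ∀ a : ℕ → S, Monotone a → ∃ s, IsLUB (Set.range a) s
  add_isLUB : ∀ (a : ℕ → S) (s b : S), Monotone a → IsLUB (Set.range a) s →
    IsLUB (Set.range fun i => b + a i) (b + s)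
  mul_left_isLUB : ∀ (a : ℕ → S) (s b : S), Monotone a → IsLUB (Set.range a) s →
    IsLUB (Set.range fun i => b * a i) (b * s)
  mul_right_isLUB : ∀ (a : ℕ → S) (s b : S), Monotone a → IsLUB (Set.range a) s →
    IsLUB (Set.range fun i => a i * b) (s * b)

section Sums

variable {S : Type*} [Semiring S] [PartialOrder S] [CanonicallyOrderedAdd S]

theorem exists_isLUB_sums [OmegaContinuous S] {ι : Type*} [Countable ι] (a : ι → S) :
    ∃ s, IsLUB (Set.range fun F : Finset ι => ∑ i ∈ F, a i) s := by
  classical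
  obtain ⟨e, he⟩ := exists_injective_nat ι
  have hfin : ∀ n : ℕ, {i : ι | e i < n}.Finite := fun n =>
    (Set.finite_lt_nat n).preimage he.injOn
  have key : ∀ F G : Finset ι, F ⊆ G → ∑ i ∈ F, a i ≤ ∑ i ∈ G, a i := by
    intro F G h
    rw [← Finset.sum_sdiff h]
    exact le_add_self
  have hmono : Monotone fun n => ∑ i ∈ (hfin n).toFinset, a i := by
    intro m n hmn
    refine key _ _ fun i hi => ?_
    simp only [Set.Finite.mem_toFinset, Set.mem_ofPred_eq] at hi ⊢
    omega
  obtain ⟨s, hs⟩ := OmegaContinuous.exists_isLUB _ hmono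
  refine ⟨s, ?_, ?_⟩
  · rintro _ ⟨F, rfl⟩
    refine le_trans (key F (hfin (F.sup e + 1)).toFinset fun i hi => ?_) (hs.1 ⟨F.sup e + 1, rfl⟩)
    simp only [Set.Finite.mem_toFinset, Set.mem_ofPred_eq]
    exact Nat.lt_succ_of_le (Finset.le_sup hi)
  · intro b hb
    refine hs.2 ?_
    rintro _ ⟨n, rfl⟩
    exact hb ⟨_, rfl⟩

open Classical in
/-- The countable sum `∑ i, a i`: the supremum of the finite partial sums. -/
noncomputable def osum {ι : Type*} (a : ι → S) : S :=
  if h : ∃ s, IsLUB (Set.range fun F : Finset ι => ∑ i ∈ F, a i) s then h.choose else 0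

/-- In an ω-continuous semiring every countable sum is the supremum of its partial sums, so the
default value in `osum` is never used. -/
theorem isLUB_osum [OmegaContinuous S] {ι : Type*} [Countable ι] (a : ι → S) :
    IsLUB (Set.range fun F : Finset ι => ∑ i ∈ F, a i) (osum a) := by
  have h := exists_isLUB_sums a
  rw [osum, dif_pos h]
  exact h.choose_spec

/-- The Kleene star `a* = ∑ i, a ^ i`. -/
noncomputable def kstar (a : S) : S := osum fun i : ℕ => a ^ i

/-- The canonical map from the extended natural numbers to `S`, with `∞ ↦ 1*`. -/
noncomputable def ofENat : ℕ∞ → S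
  | ⊤ => kstar 1
  | (n : ℕ) => (n : S)

end Sums

/-! ### Context-free grammars, derivation trees and commutative ambiguity -/

/-- A context-free grammar with alphabet `A`, variables `V` and no distinguished start symbol. -/
structure Grammar (A V : Type*) where
  rules : Finset (ContextFreeRule A V)

/-- The derivation trees of `G` with root variable `X`. The root is labelled by a rule `X → γ`,
and there is one child, a derivation tree with root variable `Y`, for each position of `γ` that
holds a variable `Y`. -/
inductive DTree {A V : Type*} (G : Grammar A V) : V → Type _ where
  | node {X : V} (r : ContextFreeRule A V) (hr : r ∈ G.rules) (hX : r.input = X)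
      (child : ∀ (i : Fin r.output.length) (Y : V),
        r.output[i] = Symbol.nonterminal Y → DTree G Y) : DTree G X

/-- The yield of a derivation tree: the word over `A` that is read off its leaves. -/
def DTree.yield {A V : Type*} {G : Grammar A V} {X : V} : DTree G X → List A
  | .node r _ _ child => (List.ofFn fun i : Fin r.output.length =>
      match h : r.output[i] with
      | .terminal a => [a]
      | .nonterminal Y => (child i Y h).yield).flatten

/-- The Parikh vector of a word. -/
def parikh {A : Type*} [DecidableEq A] (w : List A) : A → ℕ := fun a => w.count a

/-- The commutative ambiguity: the number (possibly `∞`) of derivation trees with root variable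
`X` whose yield has Parikh vector `v`. -/
noncomputable def camb {A V : Type*} [DecidableEq A] (G : Grammar A V) (X : V) (v : A → ℕ) : ℕ∞ :=
  {t : DTree G X | parikh t.yield = v}.encard

/-! ### The unfolded grammar -/

/-- Variables of the unfolded grammars: `atMost X d` is `X^{≤ d}` and `exactly X d` is `X^{= d}`. -/
inductive UVar (V : Type*) where
  | atMost (X : V) (d : ℕ) : UVar V
  | exactly (X : V) (d : ℕ) : UVar V
deriving DecidableEq

/-- Whether a symbol is a variable. -/
def isVar {A V : Type*} : Symbol A V → Bool
  | .terminal _ => false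
  | .nonterminal _ => true

/-- The positions of the word `γ` that hold a variable. -/
def varPos {A V : Type*} (γ : List (Symbol A V)) : Finset ℕ :=
  (Finset.range γ.length).filter fun i => γ[i]?.any isVar

/-- Replace every variable `Y` at a position `i` of `γ` by `z i Y`. -/
def relabel {A V W : Type*} (z : ℕ → V → W) (γ : List (Symbol A V)) : List (Symbol A W) :=
  γ.mapIdx fun i s =>
    match s with
    | .terminal a => .terminal a
    | .nonterminal Y => .nonterminal (z i Y)

open UVar in
/-- The rules of the unfolding that stem from the rule `X → γ`. -/
def unfoldRule {A V : Type*} [DecidableEq A] [DecidableEq V] (k : ℕ) (r : ContextFreeRule A V) :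
    Finset (ContextFreeRule A (UVar V)) :=
  if (varPos r.output).card = 0 then
    {⟨exactly r.input 0, relabel (fun _ Y => exactly Y 0) r.output⟩}
  else if (varPos r.output).card = 1 then
    (Finset.range (k + 1)).image fun d =>
      ⟨exactly r.input d, relabel (fun _ Y => exactly Y d) r.output⟩
  else
    (Finset.Icc 1 k).biUnion fun d =>
      ((varPos r.output).image fun j =>
        ⟨exactly r.input d,
          relabel (fun i Y => if i = j then exactly Y d else atMost Y (d - 1)) r.output⟩) ∪
      (((varPos r.output).powerset.filter fun J =>
          2 ≤ J.card ∧ (2 ≤ d ∨ J = varPos r.output)).image fun J =>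
        ⟨exactly r.input d,
          relabel (fun i Y => if i ∈ J then exactly Y (d - 1) else atMost Y (d - 2)) r.output⟩)

open UVar in
/-- The unfolding `G^{≤ k}`. Only variables `X^{≤ d}`, `X^{= d}` with `d ≤ k` occur in its rules. -/
def Grammar.unfold {A V : Type*} [DecidableEq A] [DecidableEq V] [Fintype V] (G : Grammar A V)
    (k : ℕ) : Grammar A (UVar V) where
  rules :=
    ((Finset.univ : Finset V).biUnion fun X => (Finset.range (k + 1)).biUnion fun d =>
      (Finset.range (d + 1)).image fun e =>
        ⟨atMost X d, [Symbol.nonterminal (exactly X e)]⟩) ∪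
    G.rules.biUnion (unfoldRule k)

/-! ### Algebraic systems, valuations and Newton's method -/

section Systems

variable {A V S : Type*} [CommSemiring S]

/-- The value of a monomial, i.e. of a word over letters and variables. -/
def monoVal (h : A → S) (x : V → S) : List (Symbol A V) → S
  | [] => 1
  | .terminal a :: γ => h a * monoVal h x γ
  | .nonterminal Y :: γ => x Y * monoVal h x γ

/-- The differential of a monomial at the point `u` in direction `x`, by the product rule. -/
def monoDiff (h : A → S) (u x : V → S) : List (Symbol A V) → S
  | [] => 0
  | .terminal a :: γ => h a * monoDiff h u x γ
  | .nonterminal Y :: γ => x Y * monoVal h u γ + u Y * monoDiff h u x γ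

/-- The right-hand sides `X ↦ ∑_{X → γ} γ` of the algebraic system of `G` under the valuation
`h`, evaluated at `x`. -/
def Grammar.system [DecidableEq V] (G : Grammar A V) (h : A → S) (x : V → S) : V → S :=
  fun X => ∑ r ∈ G.rules with r.input = X, monoVal h x r.output

/-- The differential at `u` of the right-hand sides, in direction `x`. -/
def Grammar.diff [DecidableEq V] (G : Grammar A V) (h : A → S) (u x : V → S) : V → S :=
  fun X => ∑ r ∈ G.rules with r.input = X, monoDiff h u x r.output

variable [PartialOrder S]

/-- `x` is the least solution of the algebraic system of `G` under `h`. -/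
def Grammar.IsLeastSolution [DecidableEq V] (G : Grammar A V) (h : A → S) (x : V → S) : Prop :=
  IsLeast {y : V → S | y = G.system h y} x

/-- `ν` is a sequence of Newton approximants of the system `x = f x`: it starts at `f 0`, and
`ν (i + 1) = ν i + Δ` where `Δ` is the least solution of the linear system
`y = Df|_{ν i} (y) + δ` for some `δ` with `f (ν i) = ν i + δ`. -/
def Grammar.IsNewtonSequence [DecidableEq V] (G : Grammar A V) (h : A → S) (ν : ℕ → V → S) :
    Prop :=
  ν 0 = G.system h 0 ∧
  ∀ i, ∃ δ Δ : V → S, G.system h (ν i) = ν i + δ ∧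
    IsLeast {y : V → S | y = G.diff h (ν i) y + δ} Δ ∧ ν (i + 1) = ν i + Δ

/-- The ω-continuous homomorphism induced by the valuation `h`, on a power series with
coefficients in `ℕ∞` and commuting variables: `s ↦ ∑ v, s v * ∏ a, h a ^ v a`. -/
noncomputable def evalSeries [CanonicallyOrderedAdd S] [Fintype A] (h : A → S)
    (s : (A → ℕ) → ℕ∞) : S :=
  osum fun v : A → ℕ => ofENat (s v) * ∏ a, h a ^ v a

end Systems

/-! ### The iterated logarithm -/

/-- `⌈log₂ log₂ k⌉` for `k ≥ 2`, and `0` for `k = 1`. -/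
def logLog (k : ℕ) : ℕ := Nat.clog 2 (Nat.clog 2 k)

/-- `logLog k` is the least natural number `m` with `k ≤ 2 ^ 2 ^ m`. -/
theorem logLog_le_iff (k m : ℕ) : logLog k ≤ m ↔ k ≤ 2 ^ 2 ^ m := by
  rw [logLog, Nat.clog_le_iff_le_pow one_lt_two, Nat.clog_le_iff_le_pow one_lt_two]

end CamNewton

open CamNewton

/-!
The weight of a derivation tree depends only on the Parikh vector of its yield, and the least
solution is the sum of the weights of all trees. Since `k = k + 1` in `S`, multiplicities beyond `k`
do not matter, so this sum does not change if one keeps only a set of trees that, for every vector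
`v`, contains at least `min (camb G X v) k` trees.

The trees of dimension at most `d` form such a set. If a tree of dimension greater than `|V| + m`
has yield `v`, then moving pumps (pieces between two nodes with the same variable) from one subtree
to another one produces trees of dimension at most `|V| + m` without changing the multiset of the
rules that are used, hence without changing `v`. Each further unit of dimension provides two
disjoint subtrees that can be rearranged independently, so the number of these trees squares with
each step of `m` and is at least `2 ^ 2 ^ m`.

Both constructions collect these trees: `X^{≤ d}` in `G^{≤ d}` sums up the trees of dimension at
most `d`, and the `i`-th Newton approximant dominates the sum of the trees of dimension at most `i`,
because one step adds the trees in which all side branches along a single path from the root have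
been accounted for before.
-/

namespace CamNewton

attribute [local instance] CanonicallyOrderedAdd.toIsOrderedRing

/-! ### Scott continuity and least fixed points -/

section Continuity

open OmegaCompletePartialOrder

theorem ωScottContinuous_of_forall_isLUB {α β : Type*} [OmegaCompletePartialOrder α]
    [OmegaCompletePartialOrder β] {f : α → β}
    (hf : ∀ (c : Chain α) (s : α), IsLUB (Set.range c) s →
      IsLUB (Set.range fun i => f (c i)) (f s)) :
    ωScottContinuous f := by
  rintro _ ⟨c, rfl⟩ _ _ s hs
  rw [← Set.range_comp]
  exact hf c s hs

theorem ωScottContinuous_of_separately {α β γ : Type*} [OmegaCompletePartialOrder α]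
    [OmegaCompletePartialOrder β] [OmegaCompletePartialOrder γ] {f : α × β → γ}
    (hsnd : ∀ a, ωScottContinuous fun b => f (a, b))
    (hfst : ∀ b, ωScottContinuous fun a => f (a, b)) : ωScottContinuous f := by
  refine ScottContinuousOn.fromProd (fun a => (hsnd a).mono ?_) (fun b => (hfst b).mono ?_)
    (fun a => (hsnd a).monotone) fun b => (hfst b).monotone
  · rintro _ ⟨_, ⟨c, rfl⟩, rfl⟩
    exact ⟨c.map OrderHom.snd, Set.range_comp Prod.snd c⟩
  · rintro _ ⟨_, ⟨c, rfl⟩, rfl⟩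
    exact ⟨c.map OrderHom.fst, Set.range_comp Prod.fst c⟩

section FixedPoints

variable {α : Type*} {f : α → α} {a x : α}

theorem monotone_iterate_of_isBot [Preorder α] (hf : Monotone f) (ha : IsBot a) :
    Monotone fun n => f^[n] a :=
  hf.monotone_iterate_of_le_map (ha _)

variable [OmegaCompletePartialOrder α]

theorem exists_isLeast_isLUB_iterate (hf : ωScottContinuous f) (ha : IsBot a) :
    ∃ x, IsLeast {y | y = f y} x ∧ IsLUB (Set.range fun n => f^[n] a) x := by
  let F : α →𝒄 α := ContinuousHom.ofFun f hf
  let c : Chain α := fixedPoints.iterateChain (F : α →o α) a (ha _)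
  refine ⟨ωSup c, ⟨?_, fun y hy => ?_⟩, isLUB_range_ωSup c⟩
  · exact (fixedPoints.ωSup_iterate_mem_fixedPoint F a (ha _)).symm
  · exact fixedPoints.ωSup_iterate_le_fixedPoint F a (ha _) (Eq.symm hy) (ha y)

theorem isLUB_iterate_of_isLeast (hf : ωScottContinuous f) (ha : IsBot a)
    (hx : IsLeast {y | y = f y} x) : IsLUB (Set.range fun n => f^[n] a) x := by
  obtain ⟨y, hy, hlub⟩ := exists_isLeast_isLUB_iterate hf ha
  rwa [hx.unique hy]

end FixedPoints

section Semiring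

variable {α S : Type*} [Semiring S] [PartialOrder S] [CanonicallyOrderedAdd S] [OmegaContinuous S]

/-- An ω-continuous semiring as an ω-complete partial order, which makes Mathlib's theory of Scott
continuity available. -/
noncomputable abbrev OmegaContinuous.toOmegaCompletePartialOrder : OmegaCompletePartialOrder S where
  ωSup c := (OmegaContinuous.exists_isLUB c c.monotone).choose
  le_ωSup c i := (OmegaContinuous.exists_isLUB c c.monotone).choose_spec.1 ⟨i, rfl⟩
  ωSup_le c _ hs :=
    (OmegaContinuous.exists_isLUB c c.monotone).choose_spec.2 (Set.forall_mem_range.2 hs)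

attribute [local instance] OmegaContinuous.toOmegaCompletePartialOrder

variable [OmegaCompletePartialOrder α] {f g : α → S}

theorem ωScottContinuous_add (hf : ωScottContinuous f) (hg : ωScottContinuous g) :
    ωScottContinuous fun x => f x + g x := by
  have hadd : ωScottContinuous fun p : S × S => p.1 + p.2 :=
    ωScottContinuous_of_separately
      (fun b => ωScottContinuous_of_forall_isLUB fun c s hs =>
        OmegaContinuous.add_isLUB c s b c.monotone hs)
      (fun b => ωScottContinuous_of_forall_isLUB fun c s hs => by
        simpa only [add_comm _ b] using OmegaContinuous.add_isLUB c s b c.monotone hs)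
  exact hadd.comp (Prod.ωScottContinuous.prodMk hf hg)

theorem ωScottContinuous_mul (hf : ωScottContinuous f) (hg : ωScottContinuous g) :
    ωScottContinuous fun x => f x * g x := by
  have hmul : ωScottContinuous fun p : S × S => p.1 * p.2 :=
    ωScottContinuous_of_separately
      (fun b => ωScottContinuous_of_forall_isLUB fun c s hs =>
        OmegaContinuous.mul_left_isLUB c s b c.monotone hs)
      (fun b => ωScottContinuous_of_forall_isLUB fun c s hs =>
        OmegaContinuous.mul_right_isLUB c s b c.monotone hs)
  exact hmul.comp (Prod.ωScottContinuous.prodMk hf hg)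

theorem ωScottContinuous_sum {ι : Type*} (s : Finset ι) {f : ι → α → S}
    (hf : ∀ i, ωScottContinuous (f i)) : ωScottContinuous fun x => ∑ i ∈ s, f i x := by
  classical
  induction s using Finset.induction_on with
  | empty => exact ωScottContinuous.const
  | insert i s hi ih =>
    simp only [Finset.sum_insert hi]
    exact ωScottContinuous_add (hf i) ih

end Semiring

end Continuity

/-! ### Algebraic systems and Newton sequences -/

section Newton

theorem Grammar.add_newtonUpdate_eq {A V S : Type*} [CommSemiring S] [DecidableEq V]
    {G : Grammar A V} {h : A → S} {ν δ Δ : V → S} (hδ : G.system h ν = ν + δ)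
    (hΔ : Δ = G.diff h ν Δ + δ) : ν + Δ = G.system h ν + G.diff h ν Δ := by
  calc ν + Δ = ν + (G.diff h ν Δ + δ) := by rw [← hΔ]
    _ = G.system h ν + G.diff h ν Δ := by rw [hδ, add_comm (G.diff h ν Δ), add_assoc]

variable {A V S : Type*} [CommSemiring S] [PartialOrder S] [CanonicallyOrderedAdd S] {h : A → S}

theorem isBot_zero : IsBot (0 : V → S) := fun _ _ => zero_le

theorem monoVal_mono {u u' : V → S} (hu : u ≤ u') (γ : List (Symbol A V)) :
    monoVal h u γ ≤ monoVal h u' γ := by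
  induction γ with
  | nil => exact le_rfl
  | cons s γ ih =>
    cases s with
    | terminal a => exact mul_le_mul' le_rfl ih
    | nonterminal Y => exact mul_le_mul' (hu Y) ih

theorem monoVal_add_monoDiff_le (u x : V → S) (γ : List (Symbol A V)) :
    monoVal h u γ + monoDiff h u x γ ≤ monoVal h (u + x) γ := by
  induction γ with
  | nil => simp only [monoVal, monoDiff, add_zero, le_refl]
  | cons s γ ih =>
    cases s with
    | terminal a =>
      simp only [monoVal, monoDiff, ← mul_add]
      exact mul_le_mul' le_rfl ih
    | nonterminal Y =>
      simp only [monoVal, monoDiff, Pi.add_apply, add_mul]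
      calc u Y * monoVal h u γ + (x Y * monoVal h u γ + u Y * monoDiff h u x γ)
          = u Y * (monoVal h u γ + monoDiff h u x γ) + x Y * monoVal h u γ := by ring
        _ ≤ _ := by
          gcongr
          exact monoVal_mono le_self_add γ

theorem monoVal_add_monoDiff_mono {u x u' x' : V → S} (hu : u ≤ u') (hx : u + x ≤ u' + x')
    (γ : List (Symbol A V)) :
    monoVal h u γ + monoDiff h u x γ ≤ monoVal h u' γ + monoDiff h u' x' γ := by
  induction γ with
  | nil => exact le_rfl
  | cons s γ ih =>
    cases s with
    | terminal a =>
      simp only [monoVal, monoDiff, ← mul_add]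
      exact mul_le_mul' le_rfl ih
    | nonterminal Y =>
      simp only [monoVal, monoDiff]
      calc u Y * monoVal h u γ + (x Y * monoVal h u γ + u Y * monoDiff h u x γ)
          = (u Y + x Y) * monoVal h u γ + u Y * monoDiff h u x γ := by ring
        _ ≤ (u' Y + x' Y) * monoVal h u γ + u' Y * monoDiff h u x γ :=
            add_le_add (mul_le_mul' (hx Y) le_rfl) (mul_le_mul' (hu Y) le_rfl)
        _ = u' Y * (monoVal h u γ + monoDiff h u x γ) + x' Y * monoVal h u γ := by ring
        _ ≤ u' Y * (monoVal h u' γ + monoDiff h u' x' γ) + x' Y * monoVal h u' γ :=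
            add_le_add (mul_le_mul' le_rfl ih) (mul_le_mul' le_rfl (monoVal_mono hu γ))
        _ = _ := by ring

section Monomials

open OmegaCompletePartialOrder

attribute [local instance] OmegaContinuous.toOmegaCompletePartialOrder

variable [OmegaContinuous S]

theorem ωScottContinuous_monoVal (γ : List (Symbol A V)) :
    ωScottContinuous fun x => monoVal h x γ := by
  induction γ with
  | nil => exact ωScottContinuous.const
  | cons s γ ih =>
    cases s with
    | terminal a => exact ωScottContinuous_mul ωScottContinuous.const ih
    | nonterminal Y => exact ωScottContinuous_mul (ωScottContinuous.apply Y) ih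

theorem ωScottContinuous_monoDiff (u : V → S) (γ : List (Symbol A V)) :
    ωScottContinuous fun x => monoDiff h u x γ := by
  induction γ with
  | nil => exact ωScottContinuous.const
  | cons s γ ih =>
    cases s with
    | terminal a => exact ωScottContinuous_mul ωScottContinuous.const ih
    | nonterminal Y =>
      exact ωScottContinuous_add
        (ωScottContinuous_mul (ωScottContinuous.apply Y) ωScottContinuous.const)
        (ωScottContinuous_mul ωScottContinuous.const ih)

end Monomials

variable [DecidableEq V] {G : Grammar A V}

theorem Grammar.system_mono : Monotone (G.system h) :=
  fun _ _ hxy _ => Finset.sum_le_sum fun r _ => monoVal_mono hxy r.output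

theorem Grammar.system_add_diff_le (u x : V → S) :
    G.system h u + G.diff h u x ≤ G.system h (u + x) := fun X => by
  simp only [Grammar.system, Grammar.diff, Pi.add_apply, ← Finset.sum_add_distrib]
  exact Finset.sum_le_sum fun r _ => monoVal_add_monoDiff_le u x r.output

theorem Grammar.system_add_diff_mono {u x u' x' : V → S} (hu : u ≤ u') (hx : u + x ≤ u' + x') :
    G.system h u + G.diff h u x ≤ G.system h u' + G.diff h u' x' := fun X => by
  simp only [Grammar.system, Grammar.diff, Pi.add_apply, ← Finset.sum_add_distrib]
  exact Finset.sum_le_sum fun r _ => monoVal_add_monoDiff_mono hu hx r.output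

theorem Grammar.add_iterate_diff_le {ν δ x : V → S} (hδ : G.system h ν = ν + δ) (hνx : ν ≤ x)
    (hx : G.system h x ≤ x) (n : ℕ) : ν + (fun y => G.diff h ν y + δ)^[n] 0 ≤ x := by
  induction n with
  | zero => simpa using hνx
  | succ n ih =>
    rw [Function.iterate_succ_apply']
    set y := (fun y => G.diff h ν y + δ)^[n] 0
    calc ν + (G.diff h ν y + δ) = G.system h ν + G.diff h ν y := by
          rw [hδ, add_comm (G.diff h ν y), add_assoc]
      _ ≤ G.system h (ν + y) := Grammar.system_add_diff_le ν y
      _ ≤ x := (Grammar.system_mono ih).trans hx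

section Continuous

open OmegaCompletePartialOrder

attribute [local instance] OmegaContinuous.toOmegaCompletePartialOrder

variable [OmegaContinuous S]

theorem Grammar.ωScottContinuous_system : ωScottContinuous (G.system h) :=
  ωScottContinuous.of_apply₂ fun _ =>
    ωScottContinuous_sum _ fun r : ContextFreeRule A V => ωScottContinuous_monoVal r.output

theorem Grammar.ωScottContinuous_diff_add (G : Grammar A V) (h : A → S) (u δ : V → S) :
    ωScottContinuous fun x => G.diff h u x + δ :=
  ωScottContinuous.of_apply₂ fun _ =>
    ωScottContinuous_add
      (ωScottContinuous_sum _ fun r : ContextFreeRule A V => ωScottContinuous_monoDiff u r.output)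
      ωScottContinuous.const

theorem Grammar.exists_isLeastSolution (G : Grammar A V) (h : A → S) :
    ∃ μ, G.IsLeastSolution h μ :=
  (exists_isLeast_isLUB_iterate Grammar.ωScottContinuous_system isBot_zero).imp fun _ hμ => hμ.1

theorem Grammar.IsLeastSolution.isLUB_iterate {μ : V → S} (hμ : G.IsLeastSolution h μ) :
    IsLUB (Set.range fun n => (G.system h)^[n] 0) μ :=
  isLUB_iterate_of_isLeast Grammar.ωScottContinuous_system isBot_zero hμ

theorem Grammar.exists_isNewtonSequence (G : Grammar A V) (h : A → S) :
    ∃ ν : ℕ → V → S, G.IsNewtonSequence h ν := by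
  have step : ∀ ν : {ν : V → S // ν ≤ G.system h ν}, ∃ ν' : {ν : V → S // ν ≤ G.system h ν},
      ∃ δ Δ : V → S, G.system h ν.1 = ν.1 + δ ∧
        IsLeast {y : V → S | y = G.diff h ν.1 y + δ} Δ ∧ ν'.1 = ν.1 + Δ := by
    rintro ⟨ν, hν⟩
    obtain ⟨δ, hδ⟩ := exists_add_of_le hν
    obtain ⟨Δ, hΔ, -⟩ :=
      exists_isLeast_isLUB_iterate (G.ωScottContinuous_diff_add h ν δ) isBot_zero
    exact ⟨⟨ν + Δ, (Grammar.add_newtonUpdate_eq hδ hΔ.1).trans_le (Grammar.system_add_diff_le ν Δ)⟩,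
      δ, Δ, hδ, hΔ, rfl⟩
  choose next hnext using step
  let ν₀ : {ν : V → S // ν ≤ G.system h ν} := ⟨G.system h 0, Grammar.system_mono (isBot_zero _)⟩
  refine ⟨fun n => (next^[n] ν₀).1, rfl, fun i => ?_⟩
  simp only [Function.iterate_succ_apply']
  exact hnext _

theorem Grammar.add_newtonUpdate_le {ν δ Δ x : V → S} (hδ : G.system h ν = ν + δ)
    (hΔ : IsLeast {y : V → S | y = G.diff h ν y + δ} Δ) (hνx : ν ≤ x) (hx : G.system h x ≤ x) :
    ν + Δ ≤ x := by
  have hcont := G.ωScottContinuous_diff_add h ν δ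
  have hlub : IsLUB (Set.range fun n => ν + (fun y => G.diff h ν y + δ)^[n] 0) (ν + Δ) := by
    have hadd : ωScottContinuous fun y : V → S => ν + y :=
      ωScottContinuous.of_apply₂ fun X =>
        ωScottContinuous_add ωScottContinuous.const (ωScottContinuous.apply X)
    let c : Chain (V → S) := ⟨_, monotone_iterate_of_isBot hcont.monotone isBot_zero⟩
    have hΔ_eq : Δ = ωSup c := ωSup_eq_of_isLUB (isLUB_iterate_of_isLeast hcont isBot_zero hΔ)
    rw [hΔ_eq]
    exact hadd.isLUB (c := c)
  exact hlub.2 (Set.forall_mem_range.2 (Grammar.add_iterate_diff_le hδ hνx hx))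

theorem Grammar.IsNewtonSequence.le_of_system_le {ν : ℕ → V → S} (hν : G.IsNewtonSequence h ν)
    {x : V → S} (hx : G.system h x ≤ x) (i : ℕ) : ν i ≤ x := by
  induction i with
  | zero =>
    rw [hν.1]
    exact (Grammar.system_mono (isBot_zero x)).trans hx
  | succ i ih =>
    obtain ⟨δ, Δ, hδ, hΔ, hstep⟩ := hν.2 i
    rw [hstep]
    exact Grammar.add_newtonUpdate_le hδ hΔ ih hx

end Continuous

end Newton

/-! ### Multiplicities -/

section Multiplicity

theorem natCast_eq_of_le {S : Type*} [AddMonoidWithOne S] {k : ℕ} (hS : (k : S) = (k : S) + 1)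
    {n : ℕ} (hn : k ≤ n) : (n : S) = (k : S) := by
  induction n, hn using Nat.le_induction with
  | base => rfl
  | succ n _ ih => rw [Nat.cast_succ, ih, ← hS]

variable {S : Type*} [Semiring S] [PartialOrder S] [CanonicallyOrderedAdd S] [OmegaContinuous S]

theorem isLUB_natCast_kstar_one : IsLUB (Set.range ((↑) : ℕ → S)) (kstar 1) := by
  have hcard : Set.range ((↑) : ℕ → S) = Set.range fun F : Finset ℕ => (F.card : S) :=
    Set.Subset.antisymm (Set.range_subset_iff.2 fun n => ⟨Finset.range n, by simp⟩)
      (Set.range_subset_iff.2 fun F => ⟨F.card, rfl⟩)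
  rw [hcard]
  simpa only [kstar, one_pow, Finset.sum_const, nsmul_eq_mul, mul_one]
    using isLUB_osum fun i : ℕ => (1 : S) ^ i

theorem natCast_le_ofENat {n : ℕ} {c : ℕ∞} (hn : (n : ℕ∞) ≤ c) : (n : S) ≤ ofENat c := by
  induction c using ENat.recTopCoe with
  | top => exact isLUB_natCast_kstar_one.1 ⟨n, rfl⟩
  | coe m => exact Nat.mono_cast (ENat.natCast_le_natCast.1 hn)

theorem ofENat_le_natCast {k : ℕ} (hS : (k : S) = (k : S) + 1) {n : ℕ} {c : ℕ∞}
    (hn : min c k ≤ n) : ofENat c ≤ (n : S) := by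
  have natCast_le : ∀ m : ℕ, min m k ≤ n → (m : S) ≤ n := by
    intro m hm
    rcases le_total m k with hmk | hkm
    · exact Nat.mono_cast (by omega)
    · rw [natCast_eq_of_le hS hkm]
      exact Nat.mono_cast (by omega)
  induction c using ENat.recTopCoe with
  | top =>
    refine isLUB_natCast_kstar_one.2 (Set.forall_mem_range.2 fun m => natCast_le m ?_)
    rw [min_eq_right le_top] at hn
    exact (min_le_right _ _).trans (ENat.natCast_le_natCast.1 hn)
  | coe m =>
    rw [← Monotone.map_min (f := ((↑) : ℕ → ℕ∞)) Nat.mono_cast, ENat.natCast_le_natCast] at hn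
    exact natCast_le m hn

end Multiplicity

/-! ### Positions of variables -/

section Positions

variable {A V : Type*}

/-- A position of a word that holds a variable, together with this variable: the index type of the
children of a derivation tree. -/
structure Pos (γ : List (Symbol A V)) where
  idx : Fin γ.length
  var : V
  eq : γ[idx] = Symbol.nonterminal var

namespace Pos

variable {s : Symbol A V} {γ : List (Symbol A V)}

theorem idx_injective : Function.Injective (idx : Pos γ → Fin γ.length) := by
  rintro ⟨i, Y, h⟩ ⟨j, Z, h'⟩ (rfl : i = j)
  rw [h] at h'
  cases h'
  rfl

noncomputable instance : Fintype (Pos γ) := Fintype.ofInjective _ idx_injective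

instance : DecidableEq (Pos γ) := idx_injective.decidableEq

instance : IsEmpty (Pos ([] : List (Symbol A V))) := ⟨fun p => p.idx.elim0⟩

def succ (p : Pos γ) : Pos (s :: γ) := ⟨p.idx.succ, p.var, p.eq⟩

def zero {Y : V} : Pos (Symbol.nonterminal Y :: γ) := ⟨⟨0, Nat.succ_pos _⟩, Y, rfl⟩

def equivConsTerminal (a : A) (γ : List (Symbol A V)) : Pos γ ≃ Pos (Symbol.terminal a :: γ) where
  toFun := succ
  invFun
    | ⟨⟨0, _⟩, _, h⟩ => nomatch h
    | ⟨⟨i + 1, hi⟩, Y, h⟩ => ⟨⟨i, Nat.lt_of_succ_lt_succ hi⟩, Y, h⟩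
  left_inv _ := rfl
  right_inv
    | ⟨⟨0, _⟩, _, h⟩ => nomatch h
    | ⟨⟨_ + 1, _⟩, _, _⟩ => rfl

def equivConsNonterminal (Y : V) (γ : List (Symbol A V)) :
    Option (Pos γ) ≃ Pos (Symbol.nonterminal Y :: γ) where
  toFun p := p.elim zero succ
  invFun
    | ⟨⟨0, _⟩, _, _⟩ => none
    | ⟨⟨i + 1, hi⟩, Y, h⟩ => some ⟨⟨i, Nat.lt_of_succ_lt_succ hi⟩, Y, h⟩
  left_inv
    | none => rfl
    | some _ => rfl
  right_inv
    | ⟨⟨0, _⟩, Z, h⟩ => by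
      have : Y = Z := Symbol.nonterminal.inj h
      subst this
      rfl
    | ⟨⟨_ + 1, _⟩, _, _⟩ => rfl

@[to_additive]
theorem prod_cons_terminal {M : Type*} [CommMonoid M] {a : A}
    (f : Pos (Symbol.terminal a :: γ) → M) : ∏ p, f p = ∏ p : Pos γ, f p.succ :=
  ((equivConsTerminal a γ).prod_comp f).symm

@[to_additive]
theorem prod_cons_nonterminal {M : Type*} [CommMonoid M] {Y : V}
    (f : Pos (Symbol.nonterminal Y :: γ) → M) :
    ∏ p, f p = f zero * ∏ p : Pos γ, f p.succ := by
  rw [← (equivConsNonterminal Y γ).prod_comp f, Fintype.prod_option]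
  rfl

theorem succ_ne_zero {Y : V} (p : Pos γ) : (p.succ : Pos (Symbol.nonterminal Y :: γ)) ≠ zero :=
  fun h => p.idx.succ_ne_zero (congrArg idx h)

theorem succ_inj {p q : Pos γ} : (p.succ : Pos (s :: γ)) = q.succ ↔ p = q :=
  ⟨fun h => idx_injective (Fin.succ_injective _ (congrArg idx h)), congrArg succ⟩

end Pos

/-- The letters of a word over letters and variables. -/
def letters : List (Symbol A V) → Multiset A
  | [] => 0
  | .terminal a :: γ => a ::ₘ letters γ
  | .nonterminal _ :: γ => letters γ

theorem coe_flatten_ofFn (γ : List (Symbol A V))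
    (F : ∀ (i : Fin γ.length) (Y : V), γ[i] = Symbol.nonterminal Y → List A) :
    (((List.ofFn fun i : Fin γ.length =>
      match h : γ[i] with
      | .terminal a => [a]
      | .nonterminal Y => F i Y h).flatten : List A) : Multiset A) =
    letters γ + ∑ p : Pos γ, (F p.idx p.var p.eq : Multiset A) := by
  induction γ with
  | nil => simp [letters]
  | cons s γ ih =>
    rw [List.ofFn_succ, List.flatten_cons, ← Multiset.coe_add]
    have ih_tail := ih fun i Y h => F i.succ Y h
    cases s with
    | terminal a =>
      rw [Pos.sum_cons_terminal, letters, Multiset.cons_add]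
      exact congrArg (a ::ₘ ·) ih_tail
    | nonterminal Y =>
      rw [Pos.sum_cons_nonterminal, letters, add_left_comm]
      exact congrArg (((F ⟨0, Nat.succ_pos _⟩ Y rfl : List A) : Multiset A) + ·) ih_tail

variable {S : Type*} [CommSemiring S] (h : A → S)

/-- The coefficient of the monomial `γ`: the product of the values of its letters. -/
def coeff (γ : List (Symbol A V)) : S := ((letters γ).map h).prod

theorem coeff_cons_terminal (a : A) (γ : List (Symbol A V)) :
    coeff h (.terminal a :: γ) = h a * coeff h γ := by
  rw [coeff, letters, Multiset.map_cons, Multiset.prod_cons, coeff]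

theorem coeff_cons_nonterminal (Y : V) (γ : List (Symbol A V)) :
    coeff h (.nonterminal Y :: γ) = coeff h γ := by
  rw [coeff, letters, coeff]

theorem monoVal_eq_coeff_mul_prod (x : V → S) (γ : List (Symbol A V)) :
    monoVal h x γ = coeff h γ * ∏ p : Pos γ, x p.var := by
  induction γ with
  | nil => simp [monoVal, coeff, letters]
  | cons s γ ih =>
    cases s with
    | terminal a =>
      rw [monoVal, ih, coeff_cons_terminal, Pos.prod_cons_terminal, mul_assoc]
      rfl
    | nonterminal Y =>
      rw [monoVal, ih, coeff_cons_nonterminal, Pos.prod_cons_nonterminal, mul_left_comm]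
      rfl

theorem monoDiff_eq_coeff_mul_sum (u x : V → S) (γ : List (Symbol A V)) :
    monoDiff h u x γ =
      coeff h γ * ∑ p : Pos γ, ∏ q : Pos γ, if q = p then x q.var else u q.var := by
  induction γ with
  | nil => simp [monoDiff]
  | cons s γ ih =>
    cases s with
    | terminal a =>
      rw [monoDiff, ih, coeff_cons_terminal, Pos.sum_cons_terminal, mul_assoc]
      simp only [Pos.prod_cons_terminal, Pos.succ_inj]
      rfl
    | nonterminal Y =>
      rw [monoDiff, ih, coeff_cons_nonterminal, Pos.sum_cons_nonterminal, monoVal_eq_coeff_mul_prod]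
      simp only [Pos.prod_cons_nonterminal, Pos.succ_inj, Pos.succ_ne_zero,
        (Pos.succ_ne_zero _).symm, if_true, if_false]
      rw [mul_add, ← Finset.mul_sum, mul_left_comm (x Y), mul_left_comm (u Y)]
      rfl

end Positions

/-! ### Derivation trees -/

section Trees

variable {A V : Type*} {G : Grammar A V}

namespace DTree

/-- The derivation tree with rule `r` at the root and children `c`. -/
def branch (r : ContextFreeRule A V) (hr : r ∈ G.rules)
    (c : ∀ p : Pos r.output, DTree G p.var) : DTree G r.input :=
  .node r hr rfl fun i Y h => c ⟨i, Y, h⟩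

theorem branch_induction {motive : ∀ X, DTree G X → Prop}
    (branch : ∀ r hr c, (∀ p, motive _ (c p)) → motive _ (branch r hr c)) :
    ∀ {X : V} (t : DTree G X), motive X t
  | _, .node r hr rfl child => branch r hr (fun p => child p.idx p.var p.eq)
      fun p => branch_induction branch (child p.idx p.var p.eq)

theorem branch_injective {r : ContextFreeRule A V} {hr : r ∈ G.rules}
    {c c' : ∀ p : Pos r.output, DTree G p.var} (h : branch r hr c = branch r hr c') : c = c' := by
  simp only [branch, node.injEq, heq_eq_eq, true_and] at h
  funext p
  exact congrFun (congrFun (congrFun h p.idx) p.var) p.eq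

theorem yield_branch (r : ContextFreeRule A V) (hr : r ∈ G.rules)
    (c : ∀ p : Pos r.output, DTree G p.var) :
    ((branch r hr c).yield : Multiset A) =
      letters r.output + ∑ p, ((c p).yield : Multiset A) := by
  rw [branch, yield]
  exact coe_flatten_ofFn r.output fun i Y h => (c ⟨i, Y, h⟩).yield

/-- The multiset of the rules that label the nodes of a derivation tree. -/
noncomputable def rules {X : V} : DTree G X → Multiset (ContextFreeRule A V)
  | .node r _ _ child => r ::ₘ ∑ p : Pos r.output, (child p.idx p.var p.eq).rules

theorem rules_branch (r : ContextFreeRule A V) (hr : r ∈ G.rules)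
    (c : ∀ p : Pos r.output, DTree G p.var) :
    (branch r hr c).rules = r ::ₘ ∑ p, (c p).rules := by
  rw [branch, rules]

theorem yield_eq_sum_rules {X : V} (t : DTree G X) :
    (t.yield : Multiset A) = (t.rules.map fun r => letters r.output).sum := by
  induction t using branch_induction with
  | branch r hr c ih =>
    rw [yield_branch, rules_branch, Multiset.map_cons, Multiset.sum_cons]
    simp only [ih]
    congr 1
    rw [← Multiset.coe_mapAddMonoidHom, map_sum, ← Multiset.coe_sumAddMonoidHom, map_sum]

theorem parikh_yield_congr [DecidableEq A] {X Y : V} {t : DTree G X} {t' : DTree G Y}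
    (h : t.rules = t'.rules) : parikh t.yield = parikh t'.yield := by
  funext a
  simp only [parikh, ← Multiset.coe_count]
  rw [yield_eq_sum_rules, yield_eq_sum_rules, h]

open Classical in
/-- The derivation trees of height less than `n`. -/
noncomputable def upTo (G : Grammar A V) : ℕ → ∀ X : V, Finset (DTree G X)
  | 0, _ => ∅
  | n + 1, X => G.rules.attach.biUnion fun r => if hX : r.1.input = X then
      (Fintype.piFinset fun p : Pos r.1.output => upTo G n p.var).image fun c =>
        node r.1 r.2 hX fun i Y h => c ⟨i, Y, h⟩
    else ∅

theorem branch_mem_upTo {r : ContextFreeRule A V} {hr : r ∈ G.rules}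
    {c : ∀ p : Pos r.output, DTree G p.var} {n : ℕ} :
    branch r hr c ∈ upTo G (n + 1) r.input ↔ ∀ p, c p ∈ upTo G n p.var := by
  classical
  simp only [upTo, Finset.mem_biUnion, Finset.mem_attach, true_and]
  constructor
  · rintro ⟨⟨r', hr'⟩, hm⟩
    split_ifs at hm with hX
    · obtain ⟨c', hc', he⟩ := Finset.mem_image.1 hm
      have h1 := he
      simp only [branch, node.injEq] at h1
      obtain ⟨rfl, -⟩ := h1
      obtain rfl := branch_injective he
      exact Fintype.mem_piFinset.1 hc'
    · simp at hm
  · intro hc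
    refine ⟨⟨r, hr⟩, ?_⟩
    rw [dif_pos rfl]
    exact Finset.mem_image.2 ⟨c, Fintype.mem_piFinset.2 hc, rfl⟩

theorem upTo_mono {m n : ℕ} (hmn : m ≤ n) (X : V) : upTo G m X ⊆ upTo G n X := by
  intro t
  revert m n
  induction t using branch_induction with
  | branch r hr c ih =>
    intro m n hmn h
    cases m with
    | zero => simp [upTo] at h
    | succ m =>
      obtain ⟨n, rfl⟩ : ∃ n', n = n' + 1 := ⟨n - 1, by omega⟩
      rw [branch_mem_upTo] at h ⊢
      exact fun p => ih p (Nat.le_of_succ_le_succ hmn) (h p)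

theorem exists_mem_upTo {X : V} (t : DTree G X) : ∃ n, t ∈ upTo G n X := by
  induction t using branch_induction with
  | branch r hr c ih =>
    choose n hn using ih
    exact ⟨Finset.univ.sup n + 1, branch_mem_upTo.2 fun p =>
      upTo_mono (Finset.le_sup (Finset.mem_univ p)) _ (hn p)⟩

theorem exists_subset_upTo {X : V} (F : Finset (DTree G X)) : ∃ n, F ⊆ upTo G n X := by
  choose n hn using exists_mem_upTo (G := G) (X := X)
  exact ⟨F.sup n, fun t ht => upTo_mono (Finset.le_sup ht) _ (hn t)⟩

theorem sum_upTo_succ [DecidableEq V] {M : Type*} [AddCommMonoid M] {n : ℕ} {X : V}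
    (g : ∀ X, DTree G X → M)
    (φ : ∀ r : ContextFreeRule A V, (∀ p : Pos r.output, DTree G p.var) → M)
    (hφ : ∀ r hr c, g r.input (branch r hr c) = φ r c) :
    ∑ t ∈ upTo G (n + 1) X, g X t = ∑ r ∈ G.rules with r.input = X,
      ∑ c ∈ Fintype.piFinset fun p : Pos r.output => upTo G n p.var, φ r c := by
  classical
  rw [upTo, Finset.sum_biUnion, Finset.sum_filter, ← Finset.sum_attach G.rules]
  · refine Finset.sum_congr rfl fun r _ => ?_
    split_ifs with hX
    · obtain ⟨r, hr⟩ := r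
      dsimp only at hX
      subst hX
      refine (Finset.sum_image fun c _ c' _ h => branch_injective (hr := hr) h).trans ?_
      exact Finset.sum_congr rfl fun c _ => hφ r hr c
    · rfl
  · rintro ⟨r, hr⟩ - ⟨r', hr'⟩ - hne
    rw [Function.onFun, Finset.disjoint_left]
    intro t ht ht'
    split_ifs at ht ht' with h1 h2
    · obtain ⟨c, -, rfl⟩ := Finset.mem_image.1 ht
      obtain ⟨c', -, he⟩ := Finset.mem_image.1 ht'
      simp only [node.injEq] at he
      exact hne (Subtype.ext he.1.symm)
    all_goals simp at ht ht'


end DTree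

end Trees

/-! ### Sums over derivation trees -/

section Weights

variable {A V S : Type*} [CommSemiring S] {G : Grammar A V}

namespace DTree

/-- The value of the yield of a derivation tree. -/
def weight (h : A → S) {X : V} (t : DTree G X) : S := ((t.yield : Multiset A).map h).prod

theorem weight_eq_prod (h : A → S) [Fintype A] [DecidableEq A] {X : V} (t : DTree G X) :
    t.weight h = ∏ a, h a ^ parikh t.yield a := by
  rw [weight, Finset.prod_multiset_map_count]
  simp only [Multiset.coe_count, parikh]
  refine Finset.prod_subset (Finset.subset_univ (t.yield : Multiset A).toFinset) fun a _ ha => ?_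
  rw [List.count_eq_zero_of_not_mem (by simpa using ha), pow_zero]

theorem weight_branch (h : A → S) (r : ContextFreeRule A V) (hr : r ∈ G.rules)
    (c : ∀ p : Pos r.output, DTree G p.var) :
    (branch r hr c).weight h = coeff h r.output * ∏ p, (c p).weight h := by
  rw [weight, yield_branch, Multiset.map_add, Multiset.prod_add, coeff]
  congr 1
  rw [← Multiset.coe_mapAddMonoidHom, map_sum, Multiset.prod_sum]
  rfl

open Classical in
/-- The sum of the weights of the derivation trees of height less than `n` with root `X` that
satisfy `P`. -/
noncomputable def treeSum (G : Grammar A V) (h : A → S) (P : ∀ X, DTree G X → Prop) (n : ℕ)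
    (X : V) : S :=
  ∑ t ∈ upTo G n X with P X t, t.weight h

variable {h : A → S}

theorem treeSum_zero (P : ∀ X, DTree G X → Prop) : treeSum G h P 0 = 0 := by
  classical
  funext X
  simp only [treeSum, upTo, Finset.filter_empty, Finset.sum_empty, Pi.zero_apply]

open Classical in
theorem treeSum_succ [DecidableEq V] {P : ∀ X, DTree G X → Prop}
    {Q : ∀ r : ContextFreeRule A V, (∀ p : Pos r.output, DTree G p.var) → Prop}
    (hPQ : ∀ r hr c, P _ (branch r hr c) ↔ Q r c) (n : ℕ) (X : V) :
    treeSum G h P (n + 1) X = ∑ r ∈ G.rules with r.input = X, coeff h r.output *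
      ∑ c ∈ Fintype.piFinset fun p : Pos r.output => upTo G n p.var with Q r c,
        ∏ p, (c p).weight h := by
  rw [treeSum, Finset.sum_filter, sum_upTo_succ (fun X t => if P X t then t.weight h else 0)
    (fun r c => if Q r c then coeff h r.output * ∏ p, (c p).weight h else 0)
    (fun r hr c => by simp only [hPQ, weight_branch])]
  simp only [Finset.mul_sum, Finset.sum_filter, mul_ite, mul_zero]

open Classical in
theorem prod_treeSum {γ : List (Symbol A V)} (P : Pos γ → ∀ X, DTree G X → Prop) (n : ℕ) :
    ∏ p, treeSum G h (P p) n p.var =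
      ∑ c ∈ Fintype.piFinset fun p : Pos γ => upTo G n p.var with ∀ p, P p _ (c p),
        ∏ p, (c p).weight h := by
  simp only [treeSum]
  rw [Finset.prod_univ_sum]
  refine Finset.sum_congr ?_ fun _ _ => rfl
  ext c
  simp only [Fintype.mem_piFinset, Finset.mem_filter, forall_and]

theorem treeSum_true_eq_iterate [DecidableEq V] (n : ℕ) :
    treeSum G h (fun _ _ => True) n = (G.system h)^[n] 0 := by
  induction n with
  | zero => exact treeSum_zero _
  | succ n ih =>
    rw [Function.iterate_succ_apply', ← ih]
    funext X
    rw [treeSum_succ (Q := fun r _ => ∀ _ : Pos r.output, True) (by simp), Grammar.system]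
    refine Finset.sum_congr rfl fun r _ => ?_
    rw [monoVal_eq_coeff_mul_prod, prod_treeSum]
    congr!

variable [PartialOrder S] [CanonicallyOrderedAdd S]

theorem treeSum_mono {P Q : ∀ X, DTree G X → Prop} (hPQ : ∀ X t, P X t → Q X t) {m n : ℕ}
    (hmn : m ≤ n) : treeSum G h P m ≤ treeSum G h Q n := by
  classical
  exact fun X => Finset.sum_le_sum_of_subset fun t ht => Finset.mem_filter.2
    ⟨upTo_mono hmn X (Finset.mem_filter.1 ht).1, hPQ X t (Finset.mem_filter.1 ht).2⟩

theorem sum_weight_le_of_treeSum_le {P : ∀ X, DTree G X → Prop} {X : V} {b : S}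
    (hb : ∀ n, treeSum G h P n X ≤ b) {F : Finset (DTree G X)} (hF : ∀ t ∈ F, P X t) :
    ∑ t ∈ F, t.weight h ≤ b := by
  classical
  obtain ⟨n, hn⟩ := exists_subset_upTo F
  exact (Finset.sum_le_sum_of_subset fun t ht => Finset.mem_filter.2 ⟨hn ht, hF t ht⟩).trans (hb n)

end DTree

end Weights

/-! ### Dimensions -/

section Argmax

variable {ι : Type*} {s J : Finset ι} {δ : ι → ℕ} {i m : ℕ}

/-- The indices in `s` at which `δ` attains its maximum. -/
def argmax (s : Finset ι) (δ : ι → ℕ) : Finset ι := {p ∈ s | δ p = s.sup δ}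

theorem mem_argmax {i : ι} : i ∈ argmax s δ ↔ i ∈ s ∧ δ i = s.sup δ := Finset.mem_filter

theorem argmax_nonempty (hs : s.Nonempty) : (argmax s δ).Nonempty :=
  let ⟨i, hi, hi_sup⟩ := s.exists_mem_eq_sup hs δ
  ⟨i, mem_argmax.2 ⟨hi, hi_sup.symm⟩⟩

theorem lt_sup_of_notMem_argmax {i : ι} (hi : i ∈ s) (hmax : i ∉ argmax s δ) : δ i < s.sup δ :=
  (Finset.le_sup hi).lt_of_ne fun heq => hmax (mem_argmax.2 ⟨hi, heq⟩)

theorem sup_eq_and_argmax_eq (hJs : J ⊆ s) (hJ : J.Nonempty) (heq : ∀ i ∈ J, δ i = m)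
    (hlt : ∀ i ∈ s, i ∉ J → δ i < m) : s.sup δ = m ∧ argmax s δ = J := by
  have hsup : s.sup δ = m := by
    refine le_antisymm (Finset.sup_le fun i hi => ?_) ?_
    · by_cases hiJ : i ∈ J
      · exact (heq i hiJ).le
      · exact (hlt i hi hiJ).le
    · obtain ⟨i, hi⟩ := hJ
      exact (heq i hi).symm.trans_le (Finset.le_sup (hJs hi))
  refine ⟨hsup, Finset.ext fun i => ?_⟩
  rw [mem_argmax, hsup]
  exact ⟨fun ⟨hi, him⟩ => by_contra fun hiJ => (hlt i hi hiJ).ne him,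
    fun hi => ⟨hJs hi, heq i hi⟩⟩

theorem exists_sup_eq_and_argmax_eq (hJs : J ⊆ s) (hJ : J.Nonempty) (hm : 0 < m ∨ J = s) :
    ∃ δ : ι → ℕ, s.sup δ = m ∧ argmax s δ = J := by
  classical
  refine ⟨fun i => if i ∈ J then m else 0, sup_eq_and_argmax_eq hJs hJ
    (fun i hi => if_pos hi) fun i hi hiJ => ?_⟩
  simpa only [if_neg hiJ] using hm.resolve_right fun hJs => hiJ (hJs ▸ hi)

theorem sup_pos_or_argmax_eq (s : Finset ι) (δ : ι → ℕ) : 0 < s.sup δ ∨ argmax s δ = s := by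
  by_contra! hne
  obtain ⟨i, hi, hmax⟩ := Finset.exists_of_ssubset ((Finset.filter_subset _ s).ssubset_of_ne hne.2)
  exact (lt_sup_of_notMem_argmax hi hmax).not_ge (hne.1.trans (Nat.zero_le _))

/-- The dimension of a node with children `s` of dimensions `δ`: the
largest of these dimensions, plus one if several children attain it. -/
def joinDim (s : Finset ι) (δ : ι → ℕ) : ℕ :=
  s.sup δ + if 2 ≤ (argmax s δ).card then 1 else 0

theorem joinDim_map {κ : Type*} (s : Finset κ) (f : κ ↪ ι) (δ : ι → ℕ) :
    joinDim (s.map f) δ = joinDim s (δ ∘ f) := by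
  rw [joinDim, joinDim, argmax, argmax, Finset.sup_map, Finset.filter_map, Finset.card_map]
  rfl

theorem joinDim_le_succ_iff :
    joinDim s δ ≤ i + 1 ↔ s = ∅ ∨ ∃ p ∈ s, δ p ≤ i + 1 ∧ ∀ q ∈ s, q ≠ p → δ q ≤ i := by
  rcases s.eq_empty_or_nonempty with rfl | hs
  · simp [joinDim, argmax]
  obtain ⟨p, hp, hp_sup⟩ := s.exists_mem_eq_sup hs δ
  have le_sup : ∀ q ∈ s, δ q ≤ s.sup δ := fun q hq => Finset.le_sup hq
  simp only [hs.ne_empty, false_or, joinDim]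
  constructor
  · intro h
    split_ifs at h with hcard
    · exact ⟨p, hp, by omega, fun q hq _ => (le_sup q hq).trans (by omega)⟩
    · refine ⟨p, hp, by omega, fun q hq hqp => ?_⟩
      have hq_lt : δ q ≠ s.sup δ := fun hq_sup => hcard <| Finset.one_lt_card.2
        ⟨p, mem_argmax.2 ⟨hp, hp_sup.symm⟩, q, mem_argmax.2 ⟨hq, hq_sup⟩, hqp.symm⟩
      have := le_sup q hq
      omega
  · rintro ⟨p', -, hp'_le, hle⟩
    split_ifs with hcard
    · obtain ⟨q, hq, hqp'⟩ := Finset.exists_mem_ne hcard p'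
      obtain ⟨hqs, hq_sup⟩ := mem_argmax.1 hq
      have := hle q hqs hqp'
      omega
    · refine Finset.sup_le fun q hq => ?_
      by_cases hqp' : q = p'
      · exact hqp' ▸ hp'_le
      · exact (hle q hq hqp').trans i.le_succ

end Argmax

namespace DTree

section Dimension

variable {A V : Type*} {G : Grammar A V}

/-- The dimension (Horton–Strahler number) of a derivation tree. -/
noncomputable def dim {X : V} : DTree G X → ℕ
  | .node r _ _ child =>
    joinDim Finset.univ fun p : Pos r.output => (child p.idx p.var p.eq).dim

theorem dim_branch (r : ContextFreeRule A V) (hr : r ∈ G.rules)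
    (c : ∀ p : Pos r.output, DTree G p.var) :
    (branch r hr c).dim = joinDim Finset.univ fun p => (c p).dim := by
  rw [branch, dim]

open Classical in
/-- The dimension of a derivation tree, except that only trees of height `0` have dimension `0`:
the number of the first Newton approximant that accounts for the tree. -/
noncomputable def newtonDim {X : V} : DTree G X → ℕ
  | .node r _ _ child =>
    if IsEmpty (Pos r.output) then 0
    else max 1 (joinDim Finset.univ fun p : Pos r.output => (child p.idx p.var p.eq).newtonDim)

variable {r : ContextFreeRule A V} {hr : r ∈ G.rules} {c : ∀ p : Pos r.output, DTree G p.var}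
  {i : ℕ}

theorem newtonDim_branch_le_zero_iff : (branch r hr c).newtonDim ≤ 0 ↔ IsEmpty (Pos r.output) := by
  rw [branch, newtonDim]
  split_ifs with hempty <;> simp [hempty]

theorem newtonDim_branch_le_succ_iff :
    (branch r hr c).newtonDim ≤ i + 1 ↔ IsEmpty (Pos r.output) ∨
      ∃ p, (c p).newtonDim ≤ i + 1 ∧ ∀ q ≠ p, (c q).newtonDim ≤ i := by
  rw [branch, newtonDim]
  split_ifs with hempty
  · simp [hempty]
  · simp [hempty, joinDim_le_succ_iff, Finset.univ_eq_empty_iff]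

theorem newtonDim_branch_le_of_forall (hc : ∀ p, (c p).newtonDim ≤ i) :
    (branch r hr c).newtonDim ≤ i + 1 := by
  rw [newtonDim_branch_le_succ_iff]
  exact (isEmpty_or_nonempty (Pos r.output)).imp_right fun ⟨p⟩ =>
    ⟨p, (hc p).trans i.le_succ, fun q _ => hc q⟩

theorem dim_le_newtonDim {X : V} (t : DTree G X) : t.dim ≤ t.newtonDim := by
  induction t using branch_induction with
  | branch r hr c ih =>
    generalize hi : (branch r hr c).newtonDim = i
    rw [dim_branch]
    cases i with
    | zero =>
      have := newtonDim_branch_le_zero_iff.1 hi.le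
      simp [joinDim, argmax]
    | succ i =>
      rw [joinDim_le_succ_iff, Finset.univ_eq_empty_iff]
      exact (newtonDim_branch_le_succ_iff.1 hi.le).imp_right fun ⟨p, hp, hle⟩ =>
        ⟨p, Finset.mem_univ p, (ih p).trans hp, fun q _ hqp => (ih q).trans (hle q hqp)⟩

end Dimension

section NewtonApproximants

variable {A V S : Type*} [CommSemiring S] {G : Grammar A V} {h : A → S}

theorem treeSum_newtonDim_le_succ (i n : ℕ) :
    treeSum G h (fun _ t => t.newtonDim ≤ i + 1) n =
      treeSum G h (fun _ t => t.newtonDim ≤ i) n +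
        treeSum G h (fun _ t => t.newtonDim = i + 1) n := by
  classical
  funext X
  simp only [treeSum, Pi.add_apply, Nat.le_succ_iff]
  rw [← Finset.sum_union (Finset.disjoint_filter.2 fun t _ => by omega), ← Finset.filter_or]

variable [PartialOrder S] [CanonicallyOrderedAdd S]

open Classical in
theorem sum_prod_weight_le {γ : List (Symbol A V)} (i n : ℕ) :
    ∑ c ∈ Fintype.piFinset fun p : Pos γ => upTo G n p.var with IsEmpty (Pos γ) ∨
        ∃ p, (c p).newtonDim ≤ i + 1 ∧ ∀ q ≠ p, (c q).newtonDim ≤ i, ∏ p, (c p).weight h ≤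
      ∏ p : Pos γ, treeSum G h (fun _ t => t.newtonDim ≤ i) n p.var +
      ∑ p : Pos γ, ∏ q : Pos γ, if q = p then treeSum G h (fun _ t => t.newtonDim = i + 1) n q.var
        else treeSum G h (fun _ t => t.newtonDim ≤ i) n q.var := by
  have prod_ite (p : Pos γ) : (∏ q : Pos γ,
      if q = p then treeSum G h (fun _ t => t.newtonDim = i + 1) n q.var
        else treeSum G h (fun _ t => t.newtonDim ≤ i) n q.var) =
      ∏ q : Pos γ, treeSum G h (fun _ t => if q = p then t.newtonDim = i + 1 else t.newtonDim ≤ i)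
        n q.var :=
    Finset.prod_congr rfl fun q _ => by split_ifs <;> rfl
  simp only [prod_ite, prod_treeSum (fun _ _ t => t.newtonDim ≤ i) n,
    prod_treeSum (fun q _ t => if q = _ then t.newtonDim = i + 1 else t.newtonDim ≤ i) n,
    Finset.sum_filter]
  rw [Finset.sum_comm, ← Finset.sum_add_distrib]
  refine Finset.sum_le_sum fun c _ => ?_
  split_ifs with hc hall
  · exact le_self_add
  · obtain ⟨p, hp, hle⟩ := hc.resolve_left fun _ => hall isEmptyElim
    have hp_eq : (c p).newtonDim = i + 1 := by
      refine hp.antisymm (Nat.lt_of_not_le fun hp' => hall fun q => ?_)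
      by_cases hqp : q = p
      · exact hqp ▸ hp'
      · exact hle q hqp
    rw [zero_add]
    have hterm : ∀ q, if q = p then (c q).newtonDim = i + 1 else (c q).newtonDim ≤ i := by
      intro q
      split_ifs with hqp
      · exact hqp ▸ hp_eq
      · exact hle q hqp
    refine le_trans ?_ (Finset.single_le_sum (fun _ _ => zero_le) (Finset.mem_univ p))
    rw [if_pos hterm]
  all_goals exact zero_le

variable [DecidableEq V]

theorem treeSum_newtonDim_le_zero_le (n : ℕ) :
    treeSum G h (fun _ t => t.newtonDim ≤ 0) n ≤ G.system h 0 := by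
  classical
  cases n with
  | zero => exact (treeSum_zero _).trans_le (isBot_zero _)
  | succ n =>
    intro X
    rw [treeSum_succ (fun r hr c => newtonDim_branch_le_zero_iff), Grammar.system]
    refine Finset.sum_le_sum fun r _ => ?_
    rw [monoVal_eq_coeff_mul_prod]
    gcongr
    by_cases hempty : IsEmpty (Pos r.output)
    · simp [hempty]
    · simp [hempty]

theorem treeSum_newtonDim_le_succ_succ_le (i n : ℕ) :
    treeSum G h (fun _ t => t.newtonDim ≤ i + 1) (n + 1) ≤
      G.system h (treeSum G h (fun _ t => t.newtonDim ≤ i) n) +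
      G.diff h (treeSum G h (fun _ t => t.newtonDim ≤ i) n)
        (treeSum G h (fun _ t => t.newtonDim = i + 1) n) := by
  classical
  intro X
  rw [treeSum_succ (fun r hr c => newtonDim_branch_le_succ_iff)]
  simp only [Pi.add_apply, Grammar.system, Grammar.diff]
  rw [← Finset.sum_add_distrib]
  refine Finset.sum_le_sum fun r _ => ?_
  rw [monoVal_eq_coeff_mul_prod, monoDiff_eq_coeff_mul_sum, ← mul_add]
  convert mul_le_mul' le_rfl (sum_prod_weight_le (G := G) (h := h) i n)

theorem treeSum_le_newton {ν : ℕ → V → S} (hν : G.IsNewtonSequence h ν) (i n : ℕ) :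
    treeSum G h (fun _ t => t.newtonDim ≤ i) n ≤ ν i := by
  induction i generalizing n with
  | zero => exact hν.1 ▸ treeSum_newtonDim_le_zero_le n
  | succ i ih =>
    induction n with
    | zero => exact (treeSum_zero _).trans_le (isBot_zero _)
    | succ n ihn =>
      obtain ⟨δ, Δ, hδ, hΔ, hstep⟩ := hν.2 i
      rw [hstep] at ihn ⊢
      rw [Grammar.add_newtonUpdate_eq hδ hΔ.1]
      rw [treeSum_newtonDim_le_succ] at ihn
      exact (treeSum_newtonDim_le_succ_succ_le i n).trans
        (Grammar.system_add_diff_mono (ih n) ihn)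

end NewtonApproximants

end DTree

/-! ### The least solution and the commutative ambiguity -/

section Ambiguity

variable {A V S : Type*} [Fintype A] [DecidableEq A] [CommSemiring S] [PartialOrder S]
  [CanonicallyOrderedAdd S] [OmegaContinuous S] {G : Grammar A V} {h : A → S}

theorem evalSeries_camb_le {k : ℕ} (hS : (k : S) = (k : S) + 1) {X : V}
    {P : DTree G X → Prop} {b : S}
    (hP : ∀ v, min (camb G X v) k ≤ {t : DTree G X | P t ∧ parikh t.yield = v}.encard)
    (hb : ∀ F : Finset (DTree G X), (∀ t ∈ F, P t) → ∑ t ∈ F, t.weight h ≤ b) :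
    evalSeries h (camb G X) ≤ b := by
  classical
  have hF : ∀ v, ∃ F : Finset (DTree G X), (∀ t ∈ F, P t ∧ parikh t.yield = v) ∧
      min (camb G X v) k = F.card := by
    intro v
    obtain ⟨T, hT, hcard⟩ := Set.exists_subset_encard_eq (hP v)
    have hfin : T.Finite := Set.finite_of_encard_le_coe (hcard.trans_le (min_le_right _ _))
    refine ⟨hfin.toFinset, fun t ht => hT (hfin.mem_toFinset.1 ht), ?_⟩
    rw [← hcard, hfin.encard_eq_coe_toFinset_card]
  choose F hFP hFcard using hF
  have hterm : ∀ v, (ofENat (camb G X v) : S) * ∏ a, h a ^ v a ≤ ∑ t ∈ F v, t.weight h := by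
    intro v
    rw [Finset.sum_congr rfl fun t ht => by rw [DTree.weight_eq_prod, (hFP v t ht).2],
      Finset.sum_const, nsmul_eq_mul]
    exact mul_le_mul' (ofENat_le_natCast hS (hFcard v).le) le_rfl
  refine (isLUB_osum _).2 (Set.forall_mem_range.2 fun U => ?_)
  calc ∑ v ∈ U, (ofENat (camb G X v) : S) * ∏ a, h a ^ v a
      ≤ ∑ v ∈ U, ∑ t ∈ F v, t.weight h := Finset.sum_le_sum fun v _ => hterm v
    _ = ∑ t ∈ U.biUnion F, t.weight h := by
        refine (Finset.sum_biUnion fun v _ w _ hvw =>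
          Finset.disjoint_left.2 fun t htv htw => ?_).symm
        exact hvw ((hFP v t htv).2.symm.trans (hFP w t htw).2)
    _ ≤ b := hb _ fun t ht => by
        obtain ⟨v, -, htv⟩ := Finset.mem_biUnion.1 ht
        exact (hFP v t htv).1

theorem sum_weight_le_evalSeries {X : V} (F : Finset (DTree G X)) :
    ∑ t ∈ F, t.weight h ≤ evalSeries h (camb G X) := by
  let vectors := F.image fun t => parikh t.yield
  refine le_trans ?_ ((isLUB_osum _).1 ⟨vectors, rfl⟩)
  rw [← Finset.sum_fiberwise_of_maps_to (g := fun t => parikh t.yield) (t := vectors)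
    fun t ht => Finset.mem_image_of_mem _ ht]
  refine Finset.sum_le_sum fun v _ => ?_
  rw [Finset.sum_congr rfl fun t ht => by
    rw [DTree.weight_eq_prod, (Finset.mem_filter.1 ht).2], Finset.sum_const, nsmul_eq_mul]
  refine mul_le_mul' (natCast_le_ofENat ?_) le_rfl
  rw [← Set.encard_coe_eq_coe_finsetCard]
  exact Set.encard_le_encard fun t ht => (Finset.mem_filter.1 ht).2

theorem isLeastSolution_evalSeries_camb [DecidableEq V] {k : ℕ} (hS : (k : S) = (k : S) + 1) :
    G.IsLeastSolution h fun X => evalSeries h (camb G X) := by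
  obtain ⟨μ, hμ⟩ := G.exists_isLeastSolution h
  have hlub := hμ.isLUB_iterate
  suffices heq : (fun X => evalSeries h (camb G X)) = μ by rwa [heq]
  refine le_antisymm (fun X => ?_) (hlub.2 (Set.forall_mem_range.2 fun n => ?_))
  · have treeSum_le (n : ℕ) : DTree.treeSum G h (fun _ _ => True) n X ≤ μ X := by
      rw [DTree.treeSum_true_eq_iterate]
      exact hlub.1 ⟨n, rfl⟩ X
    refine evalSeries_camb_le hS (P := fun _ => True) (fun v => ?_) fun F hF =>
      DTree.sum_weight_le_of_treeSum_le treeSum_le hF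
    simp only [true_and, camb, min_le_left]
  · intro X
    rw [← DTree.treeSum_true_eq_iterate]
    exact sum_weight_le_evalSeries _

end Ambiguity

/-! ### Rearranging derivation trees -/

namespace DTree

section Pumping

variable {A V : Type*} {G : Grammar A V}

theorem rules_lt_branch {r : ContextFreeRule A V} {hr : r ∈ G.rules}
    {c : ∀ p : Pos r.output, DTree G p.var} (p : Pos r.output) :
    (c p).rules < (branch r hr c).rules := by
  rw [rules_branch]
  exact (Finset.single_le_sum (f := fun p => (c p).rules) (fun _ _ => Multiset.zero_le _)
    (Finset.mem_univ p)).trans_lt (Multiset.lt_cons_self _ _)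

theorem sum_rules_update {ι : Type*} [Fintype ι] [DecidableEq ι] {X : ι → V}
    (c : ∀ p, DTree G (X p)) (p : ι) (u : DTree G (X p)) :
    ∑ q, (Function.update c p u q).rules + (c p).rules = ∑ q, (c q).rules + u.rules := by
  rw [← Finset.add_sum_erase _ _ (Finset.mem_univ p),
    ← Finset.add_sum_erase (a := p) _ (fun q => (c q).rules) (Finset.mem_univ p),
    Function.update_self, Finset.sum_congr rfl fun q hq => by
      rw [Function.update_of_ne (Finset.ne_of_mem_erase hq)]]
  abel

theorem sum_rules_update_update {ι : Type*} [Fintype ι] [DecidableEq ι] {X : ι → V}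
    (c : ∀ p, DTree G (X p)) {p q : ι} (hpq : p ≠ q) {u : DTree G (X p)} {v : DTree G (X q)}
    (huv : u.rules + v.rules = (c p).rules + (c q).rules) :
    ∑ i, (Function.update (Function.update c p u) q v i).rules = ∑ i, (c i).rules := by
  have update_p := sum_rules_update c p u
  have update_q := sum_rules_update (Function.update c p u) q v
  rw [Function.update_of_ne hpq.symm] at update_q
  refine add_right_cancel (b := (c q).rules + (c p).rules) ?_
  rw [← add_assoc, update_q, add_right_comm, update_p, add_assoc, huv, add_comm (c q).rules]

/-- `Sub s t` says that `s` is a subtree of `t`. -/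
inductive Sub {Z : V} (s : DTree G Z) : ∀ {X : V}, DTree G X → Prop
  | refl : Sub s s
  | child {r : ContextFreeRule A V} {hr : r ∈ G.rules} {c : ∀ p : Pos r.output, DTree G p.var}
      (p : Pos r.output) : Sub s (c p) → Sub s (branch r hr c)

theorem Sub.rules_le {X Z : V} {s : DTree G Z} {t : DTree G X} (h : Sub s t) :
    s.rules ≤ t.rules := by
  induction h with
  | refl => exact le_rfl
  | child p _ ih => exact ih.trans (rules_lt_branch p).le

theorem Sub.exists_replace {X Z : V} {s : DTree G Z} {t : DTree G X} (h : Sub s t)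
    (s' : DTree G Z) : ∃ t' : DTree G X, t'.rules + s.rules = t.rules + s'.rules := by
  induction h with
  | refl => exact ⟨s', add_comm _ _⟩
  | @child r hr c p _ ih =>
    obtain ⟨u, hu⟩ := ih
    refine ⟨branch r hr (Function.update c p u), ?_⟩
    rw [rules_branch, rules_branch, Multiset.cons_add, Multiset.cons_add]
    congr 1
    refine add_right_cancel (b := (c p).rules) ?_
    rw [add_right_comm, sum_rules_update, add_assoc, hu, add_left_comm, add_comm]

/-- A derivation tree is pumpable if it contains a subtree together with a smaller subtree of that
subtree that has the same root variable. -/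
def Pumpable {X : V} (t : DTree G X) : Prop :=
  ∃ (Z : V) (s s' : DTree G Z), Sub s t ∧ Sub s' s ∧ s'.rules < s.rules

theorem Pumpable.branch {r : ContextFreeRule A V} {hr : r ∈ G.rules}
    {c : ∀ p : Pos r.output, DTree G p.var} {p : Pos r.output} (h : (c p).Pumpable) :
    (branch r hr c).Pumpable :=
  let ⟨Z, s, s', hs, hs', hlt⟩ := h
  ⟨Z, s, s', hs.child p, hs', hlt⟩

variable [DecidableEq V]

/-- The variables that occur in a derivation tree. -/
noncomputable def vars {X : V} (t : DTree G X) : Finset V :=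
  (t.rules.map ContextFreeRule.input).toFinset

theorem mem_vars {X Z : V} {t : DTree G X} : Z ∈ t.vars ↔ ∃ r ∈ t.rules, r.input = Z := by
  rw [vars, Multiset.mem_toFinset, Multiset.mem_map]

theorem vars_mono {X Y : V} {t : DTree G X} {t' : DTree G Y} (h : t.rules ≤ t'.rules) :
    t.vars ⊆ t'.vars := fun _ hZ =>
  let ⟨r, hr, hrZ⟩ := mem_vars.1 hZ
  mem_vars.2 ⟨r, Multiset.mem_of_le h hr, hrZ⟩

theorem root_mem_vars {X : V} (t : DTree G X) : X ∈ t.vars := by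
  induction t using branch_induction with
  | branch r hr c _ =>
    exact mem_vars.2 ⟨r, by rw [rules_branch]; exact Multiset.mem_cons_self r _, rfl⟩

theorem card_vars_pos {X : V} (t : DTree G X) : 0 < t.vars.card :=
  Finset.card_pos.2 ⟨X, root_mem_vars t⟩

theorem exists_sub_of_mem_vars {X Z : V} {t : DTree G X} (h : Z ∈ t.vars) :
    ∃ s : DTree G Z, Sub s t := by
  induction t using branch_induction with
  | branch r hr c ih =>
    obtain ⟨r', hr', rfl⟩ := mem_vars.1 h
    rw [rules_branch, Multiset.mem_cons, Multiset.mem_sum] at hr'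
    obtain rfl | ⟨p, -, hp⟩ := hr'
    · exact ⟨_, .refl⟩
    · obtain ⟨s, hs⟩ := ih p (mem_vars.2 ⟨r', hp, rfl⟩)
      exact ⟨s, hs.child p⟩

theorem vars_subset_branch {r : ContextFreeRule A V} {hr : r ∈ G.rules}
    {c : ∀ p : Pos r.output, DTree G p.var} (p : Pos r.output) :
    (c p).vars ⊆ (branch r hr c).vars :=
  vars_mono (rules_lt_branch p).le

theorem newtonDim_lt_card_vars_of_not_pumpable {X : V} {t : DTree G X} (ht : ¬ t.Pumpable) :
    t.newtonDim < t.vars.card := by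
  induction t using branch_induction with
  | branch r hr c ih =>
    have card_lt (p : Pos r.output) : (c p).vars.card < (branch r hr c).vars.card := by
      refine Finset.card_lt_card ⟨vars_subset_branch p, fun hsub => ?_⟩
      obtain ⟨s, hs⟩ := exists_sub_of_mem_vars (hsub (root_mem_vars _))
      exact ht ⟨_, _, s, .refl, hs.child p, hs.rules_le.trans_lt (rules_lt_branch p)⟩
    obtain hempty | ⟨⟨p₀⟩⟩ := isEmpty_or_nonempty (Pos r.output)
    · exact (newtonDim_branch_le_zero_iff.2 hempty).trans_lt (card_vars_pos _)
    obtain ⟨l, hl⟩ : ∃ l, (branch r hr c).vars.card = l + 2 :=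
      Nat.exists_eq_add_of_le' ((Nat.succ_le_of_lt (card_vars_pos _)).trans_lt (card_lt p₀))
    rw [hl, Nat.lt_succ_iff]
    refine newtonDim_branch_le_of_forall fun p => ?_
    have := ih p fun hp => ht hp.branch
    have := card_lt p
    omega

theorem Pumpable.exists_move {X Y : V} {t₁ : DTree G X} {t₂ : DTree G Y} (h : t₁.Pumpable)
    (hsub : t₁.vars ⊆ t₂.vars) : ∃ (t₁' : DTree G X) (t₂' : DTree G Y),
      t₁'.rules + t₂'.rules = t₁.rules + t₂.rules ∧ t₁'.rules < t₁.rules := by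
  obtain ⟨Z, s, s', hs, hs', hlt⟩ := h
  obtain ⟨q, hq⟩ := exists_sub_of_mem_vars (hsub (vars_mono hs.rules_le (root_mem_vars s)))
  obtain ⟨t₁', ht₁'⟩ := hs.exists_replace s'
  obtain ⟨w, hw⟩ := hs'.exists_replace q
  obtain ⟨t₂', ht₂'⟩ := hq.exists_replace w
  refine ⟨t₁', t₂', ?_, ?_⟩
  · refine add_right_cancel (b := s.rules + q.rules + s'.rules) ?_
    calc t₁'.rules + t₂'.rules + (s.rules + q.rules + s'.rules)
        = (t₁'.rules + s.rules) + (t₂'.rules + q.rules) + s'.rules := by abel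
      _ = (t₁.rules + s'.rules) + t₂.rules + (w.rules + s'.rules) := by rw [ht₁', ht₂']; abel
      _ = _ := by rw [hw]; abel
  · refine lt_of_add_lt_add_right (a := s.rules) ?_
    rw [ht₁']
    gcongr

theorem exists_drain {X Y : V} (t₁ : DTree G X) (t₂ : DTree G Y) (hsub : t₁.vars ⊆ t₂.vars) :
    ∃ (t₁' : DTree G X) (t₂' : DTree G Y), t₁'.rules + t₂'.rules = t₁.rules + t₂.rules ∧
      ¬ t₁'.Pumpable ∧ (t₁.Pumpable → t₁'.rules < t₁.rules) ∧ t₂.rules ≤ t₂'.rules := by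
  induction hR : t₁.rules using Multiset.strongInductionOn generalizing t₁ t₂ with
  | ih R ih =>
    subst hR
    by_cases hp : t₁.Pumpable
    · obtain ⟨u₁, u₂, hu, hlt⟩ := hp.exists_move hsub
      have hle : t₂.rules ≤ u₂.rules := le_of_add_le_add_left (a := u₁.rules) (by rw [hu]; gcongr)
      obtain ⟨t₁', t₂', hsum, hpump, -, hle'⟩ := ih _ hlt u₁ u₂
        (((vars_mono hlt.le).trans hsub).trans (vars_mono hle)) rfl
      refine ⟨t₁', t₂', hsum.trans hu, hpump, fun _ => ?_, hle.trans hle'⟩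
      refine lt_of_le_of_lt (le_of_add_le_add_right (a := u₂.rules) ?_) hlt
      exact (add_le_add_right hle' _).trans_eq hsum
    · exact ⟨t₁, t₂, rfl, hp, fun h => absurd h hp, le_rfl⟩

theorem exists_gather {ι : Type*} [Fintype ι] {X : ι → V}
    (c : ∀ p, DTree G (X p)) (g : ι) (Q : Finset ι) (hg : g ∉ Q)
    (hQ : ∀ p ∈ Q, (c p).vars ⊆ (c g).vars) :
    ∃ c' : ∀ p, DTree G (X p), ∑ p, (c' p).rules = ∑ p, (c p).rules ∧
      (∀ p ∈ Q, ¬ (c' p).Pumpable ∧ ((c p).Pumpable → (c' p).rules < (c p).rules)) ∧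
      (∀ p ∉ Q, p ≠ g → c' p = c p) ∧ (c g).rules ≤ (c' g).rules := by
  classical
  induction Q using Finset.induction_on with
  | empty => exact ⟨c, rfl, by simp, fun _ _ _ => rfl, le_rfl⟩
  | insert a Q ha ih =>
    simp only [Finset.mem_insert, not_or] at hg
    obtain ⟨c', hsum, hQ', hrest, hle⟩ := ih hg.2 fun p hp => hQ p (Finset.mem_insert_of_mem hp)
    have hag : a ≠ g := Ne.symm hg.1
    have hca : c' a = c a := hrest a ha hag
    obtain ⟨u, v, huv, hu, hlt, hv⟩ := exists_drain (c' a) (c' g)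
      (hca ▸ (hQ a (Finset.mem_insert_self _ _)).trans (vars_mono hle))
    refine ⟨Function.update (Function.update c' a u) g v,
      (sum_rules_update_update c' hag huv).trans hsum, fun p hp => ?_, fun p hp hpg => ?_, ?_⟩
    · obtain rfl | hp := Finset.mem_insert.1 hp
      · rw [Function.update_of_ne hag, Function.update_self, ← hca]
        exact ⟨hu, hlt⟩
      · rw [Function.update_of_ne (ne_of_mem_of_not_mem hp hg.2),
          Function.update_of_ne (ne_of_mem_of_not_mem hp ha)]
        exact hQ' p hp
    · simp only [Finset.mem_insert, not_or] at hp
      rw [Function.update_of_ne hpg, Function.update_of_ne hp.1]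
      exact hrest p hp.2 hpg
    · rw [Function.update_self]
      exact hle.trans hv

end Pumping

end DTree

namespace DTree

section Rearrangements

variable {A V : Type*} {G : Grammar A V}

theorem rules_induction {motive : ∀ {X : V}, DTree G X → Prop}
    (branch : ∀ (r : ContextFreeRule A V) (hr : r ∈ G.rules)
      (c : ∀ p : Pos r.output, DTree G p.var),
      (∀ {Y : V} (s : DTree G Y), s.rules < (branch r hr c).rules → motive s) →
        motive (branch r hr c)) {X : V} (t : DTree G X) : motive t := by
  induction hR : t.rules using Multiset.strongInductionOn generalizing X t with
  | ih R ih =>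
    subst hR
    induction t using branch_induction with
    | branch r hr c _ => exact branch r hr c fun s hs => ih _ hs s rfl

/-- The derivation trees that use every rule as often as `t` does and that the `i`-th Newton
approximant accounts for. -/
def rearrangements {X : V} (t : DTree G X) (i : ℕ) : Set (DTree G X) :=
  {s | s.rules = t.rules ∧ s.newtonDim ≤ i}

theorem rearrangements_mono {X : V} (t : DTree G X) : Monotone t.rearrangements :=
  fun _ _ hij _ hs => ⟨hs.1, hs.2.trans hij⟩

variable {r : ContextFreeRule A V} {hr : r ∈ G.rules} {c : ∀ p : Pos r.output, DTree G p.var}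
  {i : ℕ}

theorem branch_mem_rearrangements {c' : ∀ p : Pos r.output, DTree G p.var} {g : Pos r.output}
    (hg : c' g ∈ (c g).rearrangements (i + 1)) (hc : ∀ p ≠ g, c' p ∈ (c p).rearrangements i) :
    branch r hr c' ∈ (branch r hr c).rearrangements (i + 1) := by
  refine ⟨?_, newtonDim_branch_le_succ_iff.2 (.inr ⟨g, hg.2, fun p hp => (hc p hp).2⟩)⟩
  rw [rules_branch, rules_branch, Finset.sum_congr rfl fun p _ => ?_]
  by_cases hp : p = g
  · exact hp ▸ hg.1
  · exact (hc p hp).1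

theorem prod_le_encard_rearrangements {d N : Pos r.output → ℕ} {g : Pos r.output}
    (hg : d g ≤ i + 1) (hd : ∀ p ≠ g, d p ≤ i)
    (hN : ∀ p, (N p : ℕ∞) ≤ ((c p).rearrangements (d p)).encard) :
    ((∏ p, N p : ℕ) : ℕ∞) ≤ ((branch r hr c).rearrangements (i + 1)).encard := by
  classical
  choose T hT hT_card using fun p => Set.exists_subset_encard_eq (hN p)
  have hT_fin (p) : (T p).Finite := Set.finite_of_encard_eq_coe (hT_card p)
  let F := (Fintype.piFinset fun p => (hT_fin p).toFinset).map
    ⟨branch r hr, fun _ _ => branch_injective⟩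
  have hF_card : F.card = ∏ p, N p := by
    rw [Finset.card_map, Fintype.card_piFinset]
    refine Finset.prod_congr rfl fun p _ => ?_
    rw [← ENat.natCast_inj, ← (hT_fin p).encard_eq_coe_toFinset_card, hT_card]
  rw [← hF_card, ← Set.encard_coe_eq_coe_finsetCard]
  refine Set.encard_le_encard fun s hs => ?_
  obtain ⟨c', hc', rfl⟩ := Finset.mem_map.1 hs
  have mem_T (p) : c' p ∈ (c p).rearrangements (d p) :=
    hT p ((hT_fin p).mem_toFinset.1 (Fintype.mem_piFinset.1 hc' p))
  exact branch_mem_rearrangements (rearrangements_mono _ hg (mem_T g)) fun p hp =>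
    rearrangements_mono _ (hd p hp) (mem_T p)

theorem le_encard_rearrangements_branch {g : Pos r.output} {N : ℕ}
    (hg : (N : ℕ∞) ≤ ((c g).rearrangements (i + 1)).encard)
    (hc : ∀ p ≠ g, ((c p).rearrangements i).Nonempty) :
    (N : ℕ∞) ≤ ((branch r hr c).rearrangements (i + 1)).encard := by
  classical
  have hprod := prod_le_encard_rearrangements (hr := hr) (g := g) (i := i)
    (d := fun p => if p = g then i + 1 else i) (N := fun p => if p = g then N else 1)
    (by simp) (fun p hp => by simp [hp]) (c := c) fun p => by
      by_cases hp : p = g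
      · subst hp
        simpa using hg
      · simpa [hp, Set.one_le_encard_iff_nonempty] using hc p hp
  simpa using hprod

theorem mul_self_le_encard_rearrangements_branch {a b : Pos r.output} (hab : a ≠ b) {N : ℕ}
    (ha : (N : ℕ∞) ≤ ((c a).rearrangements i).encard)
    (hb : (N : ℕ∞) ≤ ((c b).rearrangements i).encard)
    (hc : ∀ p, ((c p).rearrangements i).Nonempty) :
    ((N * N : ℕ) : ℕ∞) ≤ ((branch r hr c).rearrangements (i + 1)).encard := by
  classical
  have hprod := prod_le_encard_rearrangements (hr := hr) (g := a) (i := i) (d := fun _ => i)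
    (N := fun p => (if p = a then N else 1) * if p = b then N else 1)
    i.le_succ (fun _ _ => le_rfl) (c := c) fun p => by
      by_cases hpa : p = a
      · subst hpa
        simpa [hab] using ha
      by_cases hpb : p = b
      · subst hpb
        simpa [hpa] using hb
      · simpa [hpa, hpb, Set.one_le_encard_iff_nonempty] using hc p
  rwa [Finset.prod_mul_distrib, Fintype.prod_ite_eq', Fintype.prod_ite_eq'] at hprod

theorem exists_ne_lt_newtonDim (h : i + 1 < (branch r hr c).newtonDim)
    (hc : ∀ p, (c p).newtonDim ≤ i + 1) :
    ∃ a b, a ≠ b ∧ i < (c a).newtonDim ∧ i < (c b).newtonDim := by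
  by_contra! hle
  refine h.not_ge ?_
  by_cases ha : ∃ a, i < (c a).newtonDim
  · obtain ⟨a, ha⟩ := ha
    exact newtonDim_branch_le_succ_iff.2 (.inr ⟨a, hc a, fun p hp => hle a p hp.symm ha⟩)
  · push Not at ha
    exact newtonDim_branch_le_of_forall ha

variable [DecidableEq V]

theorem card_vars_le_of_ne {l : ℕ} (hl : (branch r hr c).vars.card = l + 1) {p : Pos r.output}
    (hp : (c p).vars ≠ (branch r hr c).vars) : (c p).vars.card ≤ l :=
  Nat.lt_succ_iff.1 <|
    (Finset.card_lt_card ((vars_subset_branch p).ssubset_of_ne hp)).trans_eq hl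

theorem exists_concentrate {l : ℕ} (hl : (branch r hr c).vars.card = l + 1)
    (hlt : ∀ {Y : V} (s : DTree G Y), s.rules < (branch r hr c).rules →
      (s.rearrangements s.vars.card).Nonempty)
    {g : Pos r.output} (hg : (c g).vars = (branch r hr c).vars) (Q : Finset (Pos r.output))
    (hgQ : g ∉ Q) (hQ : ∀ p ∉ Q, p ≠ g → ((c p).rearrangements l).Nonempty) :
    ∃ c' : ∀ p : Pos r.output, DTree G p.var,
      branch r hr c' ∈ (branch r hr c).rearrangements (l + 1) ∧ (c g).rules ≤ (c' g).rules ∧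
      (∀ p ∈ Q, (c p).Pumpable → (c' p).rules < (c p).rules) ∧
      ∀ p ∉ Q, p ≠ g → (c' p).rules = (c p).rules := by
  obtain ⟨c₁, hsum, hQ₁, hrest, hle⟩ := exists_gather c g Q hgQ fun p _ =>
    hg ▸ vars_subset_branch p
  have hrules : (branch r hr c₁).rules = (branch r hr c).rules := by
    rw [rules_branch, rules_branch, hsum]
  have card_vars_le (p : Pos r.output) : (c₁ p).vars.card ≤ l + 1 :=
    hl ▸ Finset.card_le_card (vars_mono (hrules ▸ (rules_lt_branch (c := c₁) p).le))
  have rearranged (p : Pos r.output) :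
      ((c₁ p).rearrangements (if p = g then l + 1 else l)).Nonempty := by
    split_ifs with hpg
    · exact (hlt _ (hrules ▸ rules_lt_branch p)).mono (rearrangements_mono _ (card_vars_le p))
    by_cases hpQ : p ∈ Q
    · have := newtonDim_lt_card_vars_of_not_pumpable (hQ₁ p hpQ).1
      have := card_vars_le p
      exact ⟨c₁ p, rfl, by omega⟩
    · exact hrest p hpQ hpg ▸ hQ p hpQ hpg
  choose c' hc' using rearranged
  have hmem : branch r hr c' ∈ (branch r hr c₁).rearrangements (l + 1) :=
    branch_mem_rearrangements (g := g) (by simpa using hc' g) fun p hp => by simpa [hp] using hc' p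
  refine ⟨c', ⟨hmem.1.trans hrules, hmem.2⟩, hle.trans_eq (hc' g).1.symm,
    fun p hp hpump => (hc' p).1.trans_lt ((hQ₁ p hp).2 hpump), fun p hp hpg => ?_⟩
  rw [(hc' p).1, hrest p hp hpg]

theorem rearrangements_card_vars_nonempty {X : V} (t : DTree G X) :
    (t.rearrangements t.vars.card).Nonempty := by
  induction t using rules_induction with
  | branch r hr c ih =>
    obtain ⟨l, hl⟩ := Nat.exists_eq_succ_of_ne_zero (card_vars_pos (branch r hr c)).ne'
    rw [hl]
    by_cases hfull : ∃ g, (c g).vars = (branch r hr c).vars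
    · classical
      obtain ⟨g, hg⟩ := hfull
      obtain ⟨c', hc', -⟩ := exists_concentrate hl ih hg (Finset.univ.erase g) (by simp)
        fun p hp hpg => absurd (Finset.mem_erase.2 ⟨hpg, Finset.mem_univ p⟩) hp
      exact ⟨_, hc'⟩
    · push Not at hfull
      choose c' hc' using fun p => ih (c p) (rules_lt_branch p)
      refine ⟨branch r hr c', ?_, newtonDim_branch_le_of_forall fun p =>
        (hc' p).2.trans (card_vars_le_of_ne hl (hfull p))⟩
      rw [rules_branch, rules_branch, Finset.sum_congr rfl fun p _ => (hc' p).1]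

theorem rearrangements_nonempty_of_card_vars_le {X : V} {t : DTree G X} {l : ℕ}
    (h : t.vars.card ≤ l) : (t.rearrangements l).Nonempty :=
  (rearrangements_card_vars_nonempty t).mono (rearrangements_mono t h)

/-- Moving the pumps of the child `a` into the child `g` makes `a` smaller, and there is also a
rearrangement in which `a` does not get smaller. -/
theorem two_le_encard_rearrangements_branch {l : ℕ} (hl : (branch r hr c).vars.card = l + 1)
    {g a : Pos r.output} (hag : a ≠ g) (hg : (c g).vars = (branch r hr c).vars)
    (ha : (c a).Pumpable) : ((2 : ℕ) : ℕ∞) ≤ ((branch r hr c).rearrangements (l + 1)).encard := by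
  classical
  obtain ⟨c₁, hc₁, -, hc₁_lt, -⟩ := exists_concentrate hl
    (fun s _ => rearrangements_card_vars_nonempty s) hg (Finset.univ.erase g) (by simp)
    fun p hp hpg => absurd (Finset.mem_erase.2 ⟨hpg, Finset.mem_univ p⟩) hp
  obtain ⟨c₂, hc₂, hc₂_le⟩ : ∃ c₂ : ∀ p : Pos r.output, DTree G p.var,
      branch r hr c₂ ∈ (branch r hr c).rearrangements (l + 1) ∧ (c a).rules ≤ (c₂ a).rules := by
    by_cases hfull : (c a).vars = (branch r hr c).vars
    · obtain ⟨c₂, hc₂, hc₂_le, -⟩ := exists_concentrate hl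
        (fun s _ => rearrangements_card_vars_nonempty s) hfull (Finset.univ.erase a) (by simp)
        fun p hp hpa => absurd (Finset.mem_erase.2 ⟨hpa, Finset.mem_univ p⟩) hp
      exact ⟨c₂, hc₂, hc₂_le⟩
    · obtain ⟨c₂, hc₂, -, -, hc₂_eq⟩ := exists_concentrate hl
        (fun s _ => rearrangements_card_vars_nonempty s) hg {p | p ≠ g ∧ p ≠ a} (by simp)
        fun p hp hpg => by
          obtain rfl : p = a := by simpa [hpg] using hp
          exact rearrangements_nonempty_of_card_vars_le (card_vars_le_of_ne hl hfull)
      exact ⟨c₂, hc₂, (hc₂_eq a (by simp) hag).ge⟩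
  have hlt : (c₁ a).rules < (c₂ a).rules :=
    (hc₁_lt a (by simpa using hag) ha).trans_le hc₂_le
  refine Order.add_one_le_of_lt (Set.one_lt_encard_iff.2 ⟨_, _, hc₁, hc₂, fun heq => ?_⟩)
  exact hlt.ne (by rw [branch_injective heq])

theorem two_le_encard_rearrangements {X : V} (t : DTree G X) (h : t.vars.card < t.newtonDim) :
    ((2 : ℕ) : ℕ∞) ≤ (t.rearrangements t.vars.card).encard := by
  induction t using branch_induction with
  | branch r hr c ih =>
    obtain ⟨l, hl⟩ := Nat.exists_eq_succ_of_ne_zero (card_vars_pos (branch r hr c)).ne'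
    by_cases hfull : ∃ g a, a ≠ g ∧ (c g).vars = (branch r hr c).vars ∧ (c a).Pumpable
    · obtain ⟨g, a, hag, hg, ha⟩ := hfull
      exact hl ▸ two_le_encard_rearrangements_branch hl hag hg ha
    push Not at hfull
    have pumpable {p : Pos r.output} (hp : (c p).vars.card ≤ (c p).newtonDim) : (c p).Pumpable :=
      by_contra fun hp' => hp.not_gt (newtonDim_lt_card_vars_of_not_pumpable hp')
    have card_le (p : Pos r.output) : (c p).vars.card ≤ l + 1 :=
      (Finset.card_le_card (vars_subset_branch p)).trans_eq hl
    rw [hl] at h ⊢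
    by_cases hchild : ∃ a, (c a).vars.card < (c a).newtonDim
    · obtain ⟨a, ha⟩ := hchild
      refine le_encard_rearrangements_branch
        ((ih a ha).trans (Set.encard_le_encard (rearrangements_mono _ (card_le a))))
        fun p hp => rearrangements_nonempty_of_card_vars_le (card_vars_le_of_ne hl fun hp' => ?_)
      exact hfull p a hp.symm hp' (pumpable ha.le)
    · push Not at hchild
      obtain ⟨a, b, hab, ha, hb⟩ := exists_ne_lt_newtonDim h fun p =>
        (hchild p).trans (card_le p)
      refine absurd (pumpable ((card_le b).trans hb)) (hfull a b hab.symm ?_)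
      exact by_contra fun ha' => (card_vars_le_of_ne hl ha').not_gt (ha.trans_le (hchild a))

theorem two_pow_le_encard_rearrangements (m : ℕ) {X : V} (t : DTree G X)
    (h : t.vars.card + m < t.newtonDim) :
    ((2 ^ 2 ^ m : ℕ) : ℕ∞) ≤ (t.rearrangements (t.vars.card + m)).encard := by
  induction m generalizing X with
  | zero => exact two_le_encard_rearrangements t h
  | succ m ihm =>
    induction t using branch_induction with
    | branch r hr c ih =>
      have card_le (p : Pos r.output) : (c p).vars.card ≤ (branch r hr c).vars.card :=
        Finset.card_le_card (vars_subset_branch p)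
      have nonempty (p : Pos r.output) :
          ((c p).rearrangements ((branch r hr c).vars.card + m)).Nonempty :=
        rearrangements_nonempty_of_card_vars_le ((card_le p).trans (Nat.le_add_right _ m))
      by_cases hchild : ∃ a, (c a).vars.card + (m + 1) < (c a).newtonDim
      · obtain ⟨a, ha⟩ := hchild
        exact le_encard_rearrangements_branch ((ih a ha).trans (Set.encard_le_encard
          (rearrangements_mono _ (Nat.add_le_add_right (card_le a) _)))) fun p _ => nonempty p
      · push Not at hchild
        obtain ⟨a, b, hab, ha, hb⟩ := exists_ne_lt_newtonDim h fun p =>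
          (hchild p).trans (Nat.add_le_add_right (card_le p) _)
        have many {p : Pos r.output}
            (hp : (branch r hr c).vars.card + m < (c p).newtonDim) : ((2 ^ 2 ^ m : ℕ) : ℕ∞) ≤
              ((c p).rearrangements ((branch r hr c).vars.card + m)).encard :=
          (ihm (c p) ((Nat.add_le_add_right (card_le p) m).trans_lt hp)).trans
            (Set.encard_le_encard (rearrangements_mono _ (Nat.add_le_add_right (card_le p) m)))
        rw [pow_succ, mul_two, pow_add]
        exact mul_self_le_encard_rearrangements_branch hab (many ha) (many hb) nonempty

end Rearrangements

end DTree

section Ambiguity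

variable {A V : Type*} [DecidableEq A] [Fintype V] {G : Grammar A V}

theorem min_camb_le_encard (m : ℕ) (X : V) (v : A → ℕ) :
    min (camb G X v) (2 ^ 2 ^ m : ℕ) ≤
      {t : DTree G X | t.newtonDim ≤ Fintype.card V + m ∧ parikh t.yield = v}.encard := by
  classical
  by_cases hlarge : ∃ t : DTree G X, parikh t.yield = v ∧ Fintype.card V + m < t.newtonDim
  · obtain ⟨t, rfl, ht⟩ := hlarge
    have card_le : t.vars.card + m ≤ Fintype.card V + m := by gcongr; exact Finset.card_le_univ _
    refine (min_le_right _ _).trans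
      ((DTree.two_pow_le_encard_rearrangements m t (card_le.trans_lt ht)).trans ?_)
    exact Set.encard_le_encard fun s hs =>
      ⟨hs.2.trans card_le, DTree.parikh_yield_congr hs.1⟩
  · push Not at hlarge
    exact (min_le_left _ _).trans (Set.encard_le_encard fun t ht => ⟨hlarge t ht, ht⟩)

theorem min_camb_le_encard_newtonDim {k d : ℕ}
    (hd : Fintype.card V + logLog k ≤ d) (X : V) (v : A → ℕ) :
    min (camb G X v) k ≤ {t : DTree G X | t.newtonDim ≤ d ∧ parikh t.yield = v}.encard :=
  (min_le_min_left _ (Nat.cast_le.2 ((logLog_le_iff k _).1 le_rfl))).trans <|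
    (min_camb_le_encard _ X v).trans <| Set.encard_le_encard fun _ ht => ⟨ht.1.trans hd, ht.2⟩

end Ambiguity

/-! ### Unfolding the grammar -/

section Relabel

variable {A V W : Type*}

theorem Pos.getElem?_eq {γ : List (Symbol A V)} (p : Pos γ) :
    γ[(p.idx : ℕ)]? = some (Symbol.nonterminal p.var) :=
  List.getElem?_eq_some_iff.2 ⟨p.idx.2, p.eq⟩

/-- A position of a word as a natural number. -/
def Pos.toNat (γ : List (Symbol A V)) : Pos γ ↪ ℕ :=
  ⟨fun p => p.idx, fun _ _ h => Pos.idx_injective (Fin.ext h)⟩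

theorem varPos_eq_map (γ : List (Symbol A V)) : varPos γ = Finset.univ.map (Pos.toNat γ) := by
  ext i
  simp only [varPos, Finset.mem_filter, Finset.mem_range, Finset.mem_map, Finset.mem_univ, true_and]
  constructor
  · rintro ⟨hi, hvar⟩
    rw [List.getElem?_eq_getElem hi] at hvar
    cases hs : γ[i] with
    | terminal a => simp [hs, isVar] at hvar
    | nonterminal Y => exact ⟨⟨⟨i, hi⟩, Y, hs⟩, rfl⟩
  · rintro ⟨p, rfl⟩
    exact ⟨p.idx.2, congrArg (Option.any isVar) p.getElem?_eq⟩

theorem Pos.toNat_mem_varPos {γ : List (Symbol A V)} (p : Pos γ) : Pos.toNat γ p ∈ varPos γ :=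
  varPos_eq_map γ ▸ Finset.mem_map_of_mem _ (Finset.mem_univ p)

theorem relabel_eq_relabel_iff {z z' : ℕ → V → W} {γ : List (Symbol A V)} :
    relabel z γ = relabel z' γ ↔
      ∀ p : Pos γ, z (Pos.toNat γ p) p.var = z' (Pos.toNat γ p) p.var := by
  constructor
  · intro h p
    have hp := congrArg (fun γ' : List (Symbol A W) => γ'[(p.idx : ℕ)]?) h
    simp only [relabel, List.getElem?_mapIdx, p.getElem?_eq, Option.map_some] at hp
    exact Symbol.nonterminal.inj (Option.some.inj hp)
  · intro h
    refine List.ext_getElem? fun i => ?_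
    rw [relabel, relabel, List.getElem?_mapIdx, List.getElem?_mapIdx]
    match hs : γ[i]? with
    | none => rfl
    | some (.terminal a) => rfl
    | some (.nonterminal Y) =>
      obtain ⟨hi, hY⟩ := List.getElem?_eq_some_iff.1 hs
      exact congrArg (fun Z => some (Symbol.nonterminal Z)) (h ⟨⟨i, hi⟩, Y, hY⟩)

theorem relabel_leftInverse {f : W → V} {z : ℕ → V → W} (hz : ∀ i, Function.LeftInverse f (z i))
    (γ : List (Symbol A V)) : relabel (fun _ => f) (relabel z γ) = γ := by
  refine List.ext_getElem? fun i => ?_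
  rw [relabel, relabel, List.getElem?_mapIdx, List.getElem?_mapIdx]
  match γ[i]? with
  | none => rfl
  | some (.terminal a) => rfl
  | some (.nonterminal Y) => exact congrArg (fun Y => some (Symbol.nonterminal Y)) (hz i Y)

theorem monoVal_relabel {S : Type*} [CommSemiring S] (h : A → S) (x : W → S) (z : ℕ → V → W)
    (γ : List (Symbol A V)) :
    monoVal h x (relabel z γ) = coeff h γ * ∏ p : Pos γ, x (z (Pos.toNat γ p) p.var) := by
  induction γ generalizing z with
  | nil => simp [relabel, monoVal, coeff, letters]
  | cons s γ ih =>
    have ih_tail := ih fun i => z (i + 1)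
    rw [relabel] at ih_tail ⊢
    rw [List.mapIdx_cons]
    cases s with
    | terminal a =>
      rw [monoVal, ih_tail, coeff_cons_terminal, Pos.prod_cons_terminal, mul_assoc]
      rfl
    | nonterminal Y =>
      rw [monoVal, ih_tail, coeff_cons_nonterminal, Pos.prod_cons_nonterminal, mul_left_comm]
      rfl

end Relabel

namespace UVar

variable {V : Type*}

/-- The variable of the original grammar that a variable of the unfolding stems from. -/
def base : UVar V → V
  | atMost X _ => X
  | exactly X _ => X

/-- The superscript of a variable of the unfolding. -/
def level : UVar V → ℕ
  | atMost _ e => e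
  | exactly _ e => e

/-- The variable `Z` of the unfolding stands for the trees whose dimension `n` satisfies
`Z.Fits n`. -/
def Fits : UVar V → ℕ → Prop
  | atMost _ e, n => n ≤ e
  | exactly _ e, n => n = e

/-- The variable of the unfolding at a position `i` that holds the variable `Y`, when `δ` are the
dimensions of the children at the positions `s`. -/
def annotation (s : Finset ℕ) (δ : ℕ → ℕ) (i : ℕ) (Y : V) : UVar V :=
  if i ∈ argmax s δ then exactly Y (s.sup δ) else atMost Y (s.sup δ - 1)

variable {s : Finset ℕ} {δ δ₀ : ℕ → ℕ} {i : ℕ} {Y : V}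

theorem base_annotation : (annotation s δ i Y).base = Y := by
  rw [annotation]
  split_ifs <;> rfl

theorem level_annotation_le : (annotation s δ i Y).level ≤ joinDim s δ := by
  rw [annotation]
  split_ifs
  · exact Nat.le_add_right _ _
  · exact (Nat.sub_le _ _).trans (Nat.le_add_right _ _)

theorem annotation_fits (hi : i ∈ s) : (annotation s δ i Y).Fits (δ i) := by
  rw [annotation]
  split_ifs with hmax
  · exact (mem_argmax.1 hmax).2
  · exact Nat.le_sub_one_of_lt (lt_sup_of_notMem_argmax hi hmax)

theorem sup_eq_and_argmax_eq_of_fits (h : ∀ i ∈ s, ∃ Y : V, (annotation s δ₀ i Y).Fits (δ i)) :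
    s.sup δ = s.sup δ₀ ∧ argmax s δ = argmax s δ₀ := by
  obtain rfl | hs := s.eq_empty_or_nonempty
  · exact ⟨rfl, rfl⟩
  refine sup_eq_and_argmax_eq (Finset.filter_subset _ _) (argmax_nonempty hs)
    (fun i hi => ?_) fun i hi hmax => ?_
  · obtain ⟨Y, heq⟩ := h i (mem_argmax.1 hi).1
    rw [annotation, if_pos hi] at heq
    exact heq
  · obtain ⟨Y, hle⟩ := h i hi
    rw [annotation, if_neg hmax] at hle
    exact Nat.lt_of_le_sub_one (Nat.zero_lt_of_lt (lt_sup_of_notMem_argmax hi hmax)) hle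

end UVar

section AnnotatedRule

open UVar

variable {A V : Type*} {r : ContextFreeRule A V} {δ : ℕ → ℕ}

/-- The rule of the unfolding that derives the trees with rule `r` at the root and children of
dimensions `δ`. -/
def annotatedRule (r : ContextFreeRule A V) (δ : ℕ → ℕ) : ContextFreeRule A (UVar V) :=
  ⟨exactly r.input (joinDim (varPos r.output) δ),
    relabel (annotation (varPos r.output) δ) r.output⟩

theorem annotatedRule_left_injective {r' : ContextFreeRule A V} {δ' : ℕ → ℕ}
    (h : annotatedRule r δ = annotatedRule r' δ') : r = r' := by
  obtain ⟨hinput, houtput⟩ := ContextFreeRule.mk.inj h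
  refine ContextFreeRule.ext (UVar.exactly.inj hinput).1 ?_
  rw [← relabel_leftInverse (f := base) (fun i Y => base_annotation) r.output, houtput,
    relabel_leftInverse fun i Y => base_annotation]

theorem annotatedRule_eq_annotatedRule_iff {δ₀ : ℕ → ℕ} :
    annotatedRule r δ = annotatedRule r δ₀ ↔ ∀ p : Pos r.output,
      (annotation (varPos r.output) δ₀ (Pos.toNat _ p) p.var).Fits (δ (Pos.toNat _ p)) := by
  constructor
  · intro h p
    rw [← relabel_eq_relabel_iff.1 (congrArg ContextFreeRule.output h) p]
    exact annotation_fits p.toNat_mem_varPos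
  · intro h
    have hfits : ∀ i ∈ varPos r.output,
        ∃ Y : V, (annotation (varPos r.output) δ₀ i Y).Fits (δ i) := by
      simp only [varPos_eq_map, Finset.forall_mem_map, Finset.mem_univ, true_imp_iff]
      exact fun p => ⟨p.var, varPos_eq_map r.output ▸ h p⟩
    obtain ⟨hsup, hmax⟩ := sup_eq_and_argmax_eq_of_fits hfits
    simp only [annotatedRule, joinDim, hsup, hmax]
    congr 2
    funext i Y
    rw [annotation, hsup, hmax, annotation]

theorem annotatedRule_eq {J : Finset ℕ} {m e : ℕ} {z : ℕ → V → UVar V}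
    (hδ : (varPos r.output).sup δ = m ∧ argmax (varPos r.output) δ = J)
    (he : m + (if 2 ≤ J.card then 1 else 0) = e)
    (hz : ∀ i ∈ varPos r.output, ∀ Y, (if i ∈ J then exactly Y m else atMost Y (m - 1)) = z i Y) :
    annotatedRule r δ = ⟨exactly r.input e, relabel z r.output⟩ := by
  rw [annotatedRule, joinDim, hδ.1, hδ.2, he]
  congr 1
  refine relabel_eq_relabel_iff.2 fun p => ?_
  rw [← hz _ p.toNat_mem_varPos, annotation, hδ.1, hδ.2]

variable [DecidableEq A] [DecidableEq V] {d : ℕ}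

theorem annotatedRule_mem_unfoldRule (h : joinDim (varPos r.output) δ ≤ d) :
    annotatedRule r δ ∈ unfoldRule d r := by
  rw [joinDim] at h
  have hsub : argmax (varPos r.output) δ ⊆ varPos r.output := Finset.filter_subset _ _
  rw [unfoldRule]
  split_ifs with hzero hone
  · rw [Finset.card_eq_zero] at hzero
    exact Finset.mem_singleton.2 (annotatedRule_eq ⟨rfl, rfl⟩ (by simp [argmax, hzero])
      (by simp [hzero]))
  · have hmax : argmax (varPos r.output) δ = varPos r.output :=
      Finset.eq_of_subset_of_card_le hsub (hone.trans_le (Finset.card_pos.2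
        (argmax_nonempty (Finset.card_pos.1 (by omega)))))
    exact Finset.mem_image.2 ⟨(varPos r.output).sup δ,
      Finset.mem_range.2 (Nat.lt_succ_of_le (le_of_add_le_left h)),
      (annotatedRule_eq ⟨rfl, hmax⟩ (by simp [hone]) fun i hi Y => if_pos hi).symm⟩
  have hpos := sup_pos_or_argmax_eq (varPos r.output) δ
  have hcard : 0 < (argmax (varPos r.output) δ).card :=
    Finset.card_pos.2 (argmax_nonempty (Finset.card_pos.1 (by omega)))
  by_cases htwo : 2 ≤ (argmax (varPos r.output) δ).card
  · rw [if_pos htwo] at h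
    exact Finset.mem_biUnion.2 ⟨(varPos r.output).sup δ + 1, Finset.mem_Icc.2 (by omega),
      Finset.mem_union_right _ (Finset.mem_image.2 ⟨argmax (varPos r.output) δ,
        Finset.mem_filter.2 ⟨Finset.mem_powerset.2 hsub, htwo, hpos.imp_left fun hpos => by omega⟩,
        (annotatedRule_eq ⟨rfl, rfl⟩ (by rw [if_pos htwo]) fun i _ Y => rfl).symm⟩)⟩
  · obtain ⟨j, hj⟩ := Finset.card_eq_one.1 (by omega : (argmax (varPos r.output) δ).card = 1)
    have hne : argmax (varPos r.output) δ ≠ varPos r.output := fun heq => by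
      rw [heq] at htwo hcard
      omega
    rw [if_neg htwo] at h
    exact Finset.mem_biUnion.2 ⟨(varPos r.output).sup δ,
      Finset.mem_Icc.2 ⟨hpos.resolve_right hne, h⟩,
      Finset.mem_union_left _ (Finset.mem_image.2 ⟨j, hsub (by simp [hj]),
        (annotatedRule_eq ⟨rfl, hj⟩ (by simp) fun i _ Y => by simp).symm⟩)⟩

theorem exists_eq_annotatedRule {r' : ContextFreeRule A (UVar V)} (h : r' ∈ unfoldRule d r) :
    ∃ δ, joinDim (varPos r.output) δ ≤ d ∧ annotatedRule r δ = r' := by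
  suffices ∃ (e : ℕ) (z : ℕ → V → UVar V) (J : Finset ℕ) (m : ℕ) (δ : ℕ → ℕ),
      ((varPos r.output).sup δ = m ∧ argmax (varPos r.output) δ = J) ∧ e ≤ d ∧
      m + (if 2 ≤ J.card then 1 else 0) = e ∧
      (∀ i ∈ varPos r.output, ∀ Y, (if i ∈ J then exactly Y m else atMost Y (m - 1)) = z i Y) ∧
      ⟨exactly r.input e, relabel z r.output⟩ = r' by
    obtain ⟨e, z, J, m, δ, hδ, hed, he, hz, rfl⟩ := this
    exact ⟨δ, by rw [joinDim, hδ.1, hδ.2, he]; exact hed, annotatedRule_eq hδ he hz⟩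
  rw [unfoldRule] at h
  split_ifs at h with hzero hone
  · rw [Finset.card_eq_zero] at hzero
    exact ⟨0, _, ∅, 0, 0, by simp [hzero, argmax], d.zero_le, rfl, by simp [hzero],
      (Finset.mem_singleton.1 h).symm⟩
  · obtain ⟨e, he, h⟩ := Finset.mem_image.1 h
    obtain ⟨δ, hδ⟩ := exists_sup_eq_and_argmax_eq (m := e) subset_rfl
      (Finset.card_pos.1 (by omega : 0 < (varPos r.output).card)) (.inr rfl)
    exact ⟨e, _, _, e, δ, hδ, Nat.lt_succ_iff.1 (Finset.mem_range.1 he), by simp [hone],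
      fun i hi Y => if_pos hi, h⟩
  · obtain ⟨e, he, h⟩ := Finset.mem_biUnion.1 h
    rw [Finset.mem_Icc] at he
    obtain h | h := Finset.mem_union.1 h
    · obtain ⟨j, hj, h⟩ := Finset.mem_image.1 h
      obtain ⟨δ, hδ⟩ := exists_sup_eq_and_argmax_eq (m := e) (Finset.singleton_subset_iff.2 hj)
        (Finset.singleton_nonempty j) (.inl he.1)
      exact ⟨e, _, _, e, δ, hδ, he.2, by simp, by simp, h⟩
    · obtain ⟨J, hJ, h⟩ := Finset.mem_image.1 h
      rw [Finset.mem_filter, Finset.mem_powerset] at hJ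
      obtain ⟨hJs, htwo, hJ⟩ := hJ
      obtain ⟨δ, hδ⟩ := exists_sup_eq_and_argmax_eq (m := e - 1) hJs
        (Finset.card_pos.1 (by omega)) (hJ.imp_left fun he => by omega)
      exact ⟨e, _, _, e - 1, δ, hδ, he.2, by rw [if_pos htwo]; omega, fun _ _ _ => rfl, h⟩

end AnnotatedRule

section DimSum

open UVar DTree

variable {A V S : Type*} [CommSemiring S] {G : Grammar A V} {h : A → S} {d n : ℕ}

/-- The dimensions of a family of derivation trees, indexed by natural numbers like the positions in
`varPos`, with the junk value `0` outside these positions. -/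
noncomputable def childDims {γ : List (Symbol A V)} (c : ∀ p : Pos γ, DTree G p.var) : ℕ → ℕ :=
  Function.extend (Pos.toNat γ) (fun p => (c p).dim) 0

theorem childDims_toNat {γ : List (Symbol A V)} (c : ∀ p : Pos γ, DTree G p.var) (p : Pos γ) :
    childDims c (Pos.toNat γ p) = (c p).dim :=
  (Pos.toNat γ).injective.extend_apply _ _ p

theorem joinDim_childDims {γ : List (Symbol A V)} (c : ∀ p : Pos γ, DTree G p.var) :
    joinDim (varPos γ) (childDims c) = joinDim Finset.univ fun p => (c p).dim := by
  rw [varPos_eq_map, joinDim_map]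
  exact congrArg _ (funext (childDims_toNat c))

/-- The approximation of the least solution of the unfolding `G.unfold d` by the derivation trees of
`G` of height less than `n`: a variable of the unfolding collects the trees whose dimension fits. -/
noncomputable def dimSum (G : Grammar A V) (h : A → S) (d n : ℕ) (Z : UVar V) : S :=
  if Z.level ≤ d then treeSum G h (fun _ t => Z.Fits t.dim) n Z.base else 0

theorem dimSum_zero : dimSum G h d 0 = 0 := by
  funext Z
  simp only [dimSum, treeSum_zero, Pi.zero_apply, ite_self]

theorem dimSum_atMost {e : ℕ} (he : e ≤ d) (X : V) :
    dimSum G h d n (atMost X e) = treeSum G h (fun _ t => t.dim ≤ e) n X :=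
  if_pos he

theorem dimSum_exactly {e : ℕ} (he : e ≤ d) (X : V) :
    dimSum G h d n (exactly X e) = treeSum G h (fun _ t => t.dim = e) n X :=
  if_pos he

theorem dimSum_of_lt_level {Z : UVar V} (hZ : d < Z.level) : dimSum G h d n Z = 0 :=
  if_neg hZ.not_ge

theorem dimSum_le_treeSum [PartialOrder S] [CanonicallyOrderedAdd S] (Z : UVar V) :
    dimSum G h d n Z ≤ treeSum G h (fun _ _ => True) n Z.base := by
  rw [dimSum]
  split_ifs
  · exact treeSum_mono (fun _ _ _ => trivial) le_rfl Z.base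
  · exact zero_le

theorem dimSum_mono [PartialOrder S] [CanonicallyOrderedAdd S] {m : ℕ} (hmn : m ≤ n) :
    dimSum G h d m ≤ dimSum G h d n := by
  intro Z
  rw [dimSum, dimSum]
  split_ifs
  · exact treeSum_mono (fun _ _ => id) hmn Z.base
  · exact le_rfl

theorem dimSum_atMost_eq_sum {e : ℕ} (he : e ≤ d) (X : V) :
    dimSum G h d n (atMost X e) = ∑ e' ∈ Finset.range (e + 1), dimSum G h d n (exactly X e') := by
  classical
  have dimSum_summand (e') (he' : e' ∈ Finset.range (e + 1)) :
      dimSum G h d n (exactly X e') =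
        ∑ t ∈ (upTo G n X).filter (fun t => t.dim ≤ e) with t.dim = e', t.weight h := by
    have hle : e' ≤ e := Nat.lt_succ_iff.1 (Finset.mem_range.1 he')
    rw [dimSum_exactly (hle.trans he), treeSum, Finset.filter_filter]
    refine Finset.sum_congr ?_ fun _ _ => rfl
    ext t
    simp only [Finset.mem_filter]
    exact and_congr_right fun _ => ⟨fun ht => ⟨ht.le.trans hle, ht⟩, And.right⟩
  rw [Finset.sum_congr rfl dimSum_summand, Finset.sum_fiberwise_of_maps_to fun t ht =>
    Finset.mem_range.2 (Nat.lt_succ_iff.2 (Finset.mem_filter.1 ht).2), dimSum_atMost he, treeSum]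
  congr!

variable [DecidableEq A] [DecidableEq V]

theorem monoVal_dimSum_annotatedRule (r : ContextFreeRule A V) {δ : ℕ → ℕ}
    (hδ : joinDim (varPos r.output) δ ≤ d) :
    monoVal h (dimSum G h d n) (annotatedRule r δ).output = coeff h r.output *
      ∑ c ∈ Fintype.piFinset fun p : Pos r.output => upTo G n p.var with
        annotatedRule r (childDims c) = annotatedRule r δ, ∏ p, (c p).weight h := by
  have factor (p : Pos r.output) :
      dimSum G h d n (annotation (varPos r.output) δ (Pos.toNat _ p) p.var) =
        treeSum G h (fun _ t => (annotation (varPos r.output) δ (Pos.toNat _ p) p.var).Fits t.dim)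
          n p.var := by
    rw [dimSum, if_pos (level_annotation_le.trans hδ), base_annotation]
  rw [annotatedRule, monoVal_relabel, Finset.prod_congr rfl fun p _ => factor p, prod_treeSum
    fun p _ t => (annotation (varPos r.output) δ (Pos.toNat _ p) p.var).Fits t.dim]
  simp only [← childDims_toNat, ← annotatedRule_eq_annotatedRule_iff]
  congr!

theorem sum_monoVal_dimSum_unfoldRule (r : ContextFreeRule A V) {e : ℕ} (he : e ≤ d) :
    ∑ r' ∈ unfoldRule d r with r'.input = exactly r.input e, monoVal h (dimSum G h d n) r'.output =
      coeff h r.output * ∑ c ∈ Fintype.piFinset fun p : Pos r.output => upTo G n p.var with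
        (joinDim Finset.univ fun p => (c p).dim) = e, ∏ p, (c p).weight h := by
  simp only [← joinDim_childDims]
  rw [← Finset.sum_fiberwise_of_maps_to (g := fun c => annotatedRule r (childDims c))
    (t := (unfoldRule d r).filter fun r' => r'.input = exactly r.input e), Finset.mul_sum]
  · refine Finset.sum_congr rfl fun r' hr' => ?_
    obtain ⟨hr', hinput⟩ := Finset.mem_filter.1 hr'
    obtain ⟨δ, hδ, rfl⟩ := exists_eq_annotatedRule hr'
    rw [monoVal_dimSum_annotatedRule r hδ, Finset.filter_filter]
    congr 2
    refine Finset.filter_congr fun c _ => (and_iff_right_of_imp fun heq => ?_).symm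
    rw [← heq] at hinput
    exact (UVar.exactly.inj hinput).2
  · intro c hc
    have hdim := (Finset.mem_filter.1 hc).2
    refine Finset.mem_filter.2 ⟨annotatedRule_mem_unfoldRule (hdim.trans_le he), ?_⟩
    rw [annotatedRule, hdim]

end DimSum

section UnfoldedSystem

open UVar DTree

variable {A V S : Type*} [DecidableEq A] [Fintype V] [DecidableEq V] [CommSemiring S]
  {G : Grammar A V} {h : A → S} {d n : ℕ}

theorem Grammar.mem_rules_unfold {r : ContextFreeRule A (UVar V)} :
    r ∈ (G.unfold d).rules ↔
      (∃ X, ∃ e ≤ d, ∃ e' ≤ e, ⟨atMost X e, [Symbol.nonterminal (exactly X e')]⟩ = r) ∨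
        ∃ r₀ ∈ G.rules, r ∈ unfoldRule d r₀ := by
  simp only [Grammar.unfold, Finset.mem_union, Finset.mem_biUnion, Finset.mem_univ, true_and,
    Finset.mem_image, Finset.mem_range, Nat.lt_succ_iff]

theorem Grammar.filter_rules_unfold_atMost (X : V) (e : ℕ) :
    ((G.unfold d).rules.filter fun r => r.input = atMost X e) =
      if e ≤ d then (Finset.range (e + 1)).image fun e' =>
        ⟨atMost X e, [Symbol.nonterminal (exactly X e')]⟩
      else ∅ := by
  ext r
  rw [Finset.mem_filter, Grammar.mem_rules_unfold]
  constructor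
  · rintro ⟨⟨Y, l, hl, e', he', rfl⟩ | ⟨r₀, -, hr⟩, hinput⟩
    · obtain ⟨rfl, rfl⟩ := UVar.atMost.inj hinput
      rw [if_pos hl]
      exact Finset.mem_image_of_mem _ (Finset.mem_range.2 (Nat.lt_succ_iff.2 he'))
    · obtain ⟨δ, -, rfl⟩ := exists_eq_annotatedRule hr
      cases hinput
  · split_ifs with he
    · intro hr
      obtain ⟨e', he', rfl⟩ := Finset.mem_image.1 hr
      exact ⟨.inl ⟨X, e, he, e', Nat.lt_succ_iff.1 (Finset.mem_range.1 he'), rfl⟩, rfl⟩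
    · exact fun hr => absurd hr (Finset.notMem_empty r)

theorem Grammar.system_unfold_atMost (x : UVar V → S) (X : V) (e : ℕ) :
    (G.unfold d).system h x (atMost X e) =
      if e ≤ d then ∑ e' ∈ Finset.range (e + 1), x (exactly X e') else 0 := by
  rw [Grammar.system, Grammar.filter_rules_unfold_atMost]
  split_ifs
  · rw [Finset.sum_image fun _ _ _ _ heq => by simpa using heq]
    simp only [monoVal, mul_one]
  · rfl

theorem Grammar.filter_rules_unfold_exactly (X : V) (e : ℕ) :
    ((G.unfold d).rules.filter fun r => r.input = exactly X e) =
      (G.rules.filter fun r => r.input = X).biUnion fun r =>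
        (unfoldRule d r).filter fun r' => r'.input = exactly X e := by
  ext r'
  simp only [Finset.mem_filter, Grammar.mem_rules_unfold, Finset.mem_biUnion]
  constructor
  · rintro ⟨⟨Y, l, -, e', -, rfl⟩ | ⟨r, hr, hr'⟩, hinput⟩
    · cases hinput
    · obtain ⟨δ, -, rfl⟩ := exists_eq_annotatedRule hr'
      exact ⟨r, ⟨hr, (UVar.exactly.inj hinput).1⟩, hr', hinput⟩
  · rintro ⟨r, ⟨hr, -⟩, hr', hinput⟩
    exact ⟨.inr ⟨r, hr, hr'⟩, hinput⟩

theorem Grammar.system_unfold_exactly (x : UVar V → S) (X : V) (e : ℕ) :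
    (G.unfold d).system h x (exactly X e) = ∑ r ∈ G.rules with r.input = X,
      ∑ r' ∈ unfoldRule d r with r'.input = exactly X e, monoVal h x r'.output := by
  rw [Grammar.system, Grammar.filter_rules_unfold_exactly,
    Finset.sum_biUnion fun r _ r' _ hne => Finset.disjoint_left.2 fun r'' hr hr' => hne ?_]
  obtain ⟨δ, -, rfl⟩ := exists_eq_annotatedRule (Finset.mem_filter.1 hr).1
  obtain ⟨δ', -, heq⟩ := exists_eq_annotatedRule (Finset.mem_filter.1 hr').1
  exact annotatedRule_left_injective heq.symm

theorem system_unfold_dimSum_atMost (X : V) (e : ℕ) :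
    (G.unfold d).system h (dimSum G h d n) (atMost X e) = dimSum G h d n (atMost X e) := by
  rw [Grammar.system_unfold_atMost]
  split_ifs with he
  · rw [dimSum_atMost_eq_sum he]
  · rw [dimSum_of_lt_level (not_le.1 he)]

theorem system_unfold_dimSum_exactly (X : V) (e : ℕ) :
    (G.unfold d).system h (dimSum G h d n) (exactly X e) = dimSum G h d (n + 1) (exactly X e) := by
  classical
  rw [Grammar.system_unfold_exactly]
  obtain he | he := le_or_gt e d
  · rw [dimSum_exactly he, treeSum_succ fun r hr c => by rw [dim_branch]]
    refine Finset.sum_congr rfl fun r hr => ?_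
    rw [← (Finset.mem_filter.1 hr).2, sum_monoVal_dimSum_unfoldRule r he]
    congr!
  · rw [dimSum_of_lt_level he]
    refine Finset.sum_eq_zero fun r _ => Finset.sum_eq_zero fun r' hr' => ?_
    obtain ⟨δ, hδ, rfl⟩ := exists_eq_annotatedRule (Finset.mem_filter.1 hr').1
    exact absurd ((UVar.exactly.inj (Finset.mem_filter.1 hr').2).2 ▸ hδ) he.not_ge

end UnfoldedSystem

section UnfoldedSolution

variable {A V S : Type*} [DecidableEq A] [Fintype V] [DecidableEq V] [CommSemiring S]
  [PartialOrder S] [CanonicallyOrderedAdd S] {G : Grammar A V} {h : A → S} {d : ℕ}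

theorem iterate_system_unfold_le_dimSum (n : ℕ) :
    ((G.unfold d).system h)^[n] 0 ≤ dimSum G h d n := by
  induction n with
  | zero => exact dimSum_zero.ge
  | succ n ih =>
    rw [Function.iterate_succ_apply']
    refine (Grammar.system_mono ih).trans fun Z => ?_
    cases Z with
    | exactly X e => exact (system_unfold_dimSum_exactly X e).le
    | atMost X e => exact (system_unfold_dimSum_atMost X e).trans_le (dimSum_mono n.le_succ _)

theorem dimSum_le_of_system_le {y : UVar V → S} (hy : (G.unfold d).system h y ≤ y) (n : ℕ) :
    dimSum G h d n ≤ y := by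
  induction n with
  | zero => exact dimSum_zero.trans_le (isBot_zero y)
  | succ n ih =>
    have exactly_le (X : V) (e : ℕ) : dimSum G h d (n + 1) (.exactly X e) ≤ y (.exactly X e) :=
      (system_unfold_dimSum_exactly X e).ge.trans ((Grammar.system_mono ih).trans hy _)
    rintro (⟨X, e⟩ | ⟨X, e⟩)
    · refine le_trans ?_ (hy _)
      rw [← system_unfold_dimSum_atMost, Grammar.system_unfold_atMost, Grammar.system_unfold_atMost]
      split_ifs
      · exact Finset.sum_le_sum fun e' _ => exactly_le X e'
      · exact le_rfl
    · exact exactly_le X e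

end UnfoldedSolution

/-! ### Solutions modulo a multiplicity -/

section Solution

variable {A V S : Type*} [Fintype A] [DecidableEq A] [Fintype V] [DecidableEq V] [CommSemiring S]
  [PartialOrder S] [CanonicallyOrderedAdd S] [OmegaContinuous S] {G : Grammar A V} {h : A → S}
  {k d : ℕ}

theorem Grammar.IsNewtonSequence.eq_evalSeries_camb (hS : (k : S) = (k : S) + 1)
    (hd : Fintype.card V + logLog k ≤ d) {ν : ℕ → V → S} (hν : G.IsNewtonSequence h ν) :
    ν d = fun X => evalSeries h (camb G X) := by
  refine le_antisymm (hν.le_of_system_le (isLeastSolution_evalSeries_camb hS).1.ge d) fun X => ?_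
  exact evalSeries_camb_le hS (min_camb_le_encard_newtonDim hd X) fun _ hF =>
    DTree.sum_weight_le_of_treeSum_le (fun n => DTree.treeSum_le_newton hν d n X) hF

theorem evalSeries_camb_unfold_le (hS : (k : S) = (k : S) + 1) (X : V) :
    evalSeries h (camb (G.unfold d) (.atMost X d)) ≤ evalSeries h (camb G X) := by
  have hμ := isLeastSolution_evalSeries_camb (G := G) (h := h) hS
  have hη := isLeastSolution_evalSeries_camb (G := G.unfold d) (h := h) hS
  let trees (Z : UVar V) : S := evalSeries h (camb G Z.base)
  suffices hle : (fun Z => evalSeries h (camb (G.unfold d) Z)) ≤ trees from hle (.atMost X d)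
  refine hη.isLUB_iterate.2 (Set.forall_mem_range.2 fun n Z => ?_)
  calc ((G.unfold d).system h)^[n] 0 Z
      ≤ dimSum G h d n Z := iterate_system_unfold_le_dimSum n Z
    _ ≤ DTree.treeSum G h (fun _ _ => True) n Z.base := dimSum_le_treeSum Z
    _ = (G.system h)^[n] 0 Z.base := by rw [DTree.treeSum_true_eq_iterate]
    _ ≤ trees Z := hμ.isLUB_iterate.1 ⟨n, rfl⟩ Z.base

theorem evalSeries_camb_le_unfold (hS : (k : S) = (k : S) + 1)
    (hd : Fintype.card V + logLog k ≤ d) (X : V) :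
    evalSeries h (camb G X) ≤ evalSeries h (camb (G.unfold d) (.atMost X d)) := by
  have hη := isLeastSolution_evalSeries_camb (G := G.unfold d) (h := h) hS
  have treeSum_le (n : ℕ) : DTree.treeSum G h (fun _ t => t.dim ≤ d) n X ≤
      evalSeries h (camb (G.unfold d) (.atMost X d)) := by
    rw [← dimSum_atMost le_rfl]
    exact dimSum_le_of_system_le hη.1.ge n (.atMost X d)
  exact evalSeries_camb_le hS (fun v => (min_camb_le_encard_newtonDim hd X v).trans
      (Set.encard_le_encard fun t ht => ⟨t.dim_le_newtonDim.trans ht.1, ht.2⟩))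
    fun _ hF => DTree.sum_weight_le_of_treeSum_le treeSum_le hF

theorem isLeastSolution_evalSeries_camb_unfold (hS : (k : S) = (k : S) + 1)
    (hd : Fintype.card V + logLog k ≤ d) :
    G.IsLeastSolution h fun X => evalSeries h (camb (G.unfold d) (.atMost X d)) := by
  have heq (X : V) : evalSeries h (camb (G.unfold d) (.atMost X d)) = evalSeries h (camb G X) :=
    le_antisymm (evalSeries_camb_unfold_le hS X) (evalSeries_camb_le_unfold hS hd X)
  simp only [heq]
  exact isLeastSolution_evalSeries_camb hS

end Solution

end CamNewton

theorem mainTheorem6 {A V S : Type*} [Fintype A] [DecidableEq A] [Fintype V] [DecidableEq V]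
    [CommSemiring S] [PartialOrder S] [CanonicallyOrderedAdd S] [OmegaContinuous S]
    (G : Grammar A V) (h : A → S) (k : ℕ) (hk : 0 < k) (hS : (k : S) = (k : S) + 1)
    (d : ℕ) (hd : d = Fintype.card V + logLog k) :
    G.IsLeastSolution h (fun X => evalSeries h (camb (G.unfold d) (UVar.atMost X d))) ∧
    (∃ ν : ℕ → V → S, G.IsNewtonSequence h ν) ∧
    (∀ ν : ℕ → V → S, G.IsNewtonSequence h ν → ∀ i, d ≤ i → G.IsLeastSolution h (ν i)) := by
  refine ⟨isLeastSolution_evalSeries_camb_unfold hS hd.ge, G.exists_isNewtonSequence h,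
    fun ν hν i hi => ?_⟩
  rw [hν.eq_evalSeries_camb hS (hd.ge.trans hi)]
  exact isLeastSolution_evalSeries_camb hS
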